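/- Let $X$ be a complex manifold with a Hermitian metric, that is, a smooth Riemannian metric $g$ on the underlying smooth manifold with $g(Ju,Jv)=g(u,v)$, where $J$ is the complex structure; extend $g$ complex-bilinearly to $TX\otimes\mathbb C=T^{1,0}X\oplus T^{0,1}X$. Let ${}^c\nabla$ be the Chern connection on $T^{1,0}X$, i.e. the connection preserving the Hermitian metric $g(\cdot,\overline{\,\cdot\,})$ and satisfying ${}^c\nabla^{0,1}=\bar\partial$, where $\bar\partial_{\bar u}v=[\bar u,v]^{1,0}$. Let ${}^l\nabla$ be the Lichnerowicz connection, i.e. the complex-linear extension of the Levi-Civita connection of $g$, restricted to $T^{1,0}X$ and projected to $T^{1,0}X$. For $t\in\mathbb R$ let ${}^t\nabla=t\,{}^c\nabla+(1-t)\,{}^l\nabla$ be the $t$-Gauduchon connection. Let $e_1,\dots,e_n$ be a smooth local unitary frame of $T^{1,0}X$ (so $g(e_i,\bar e_j)=\delta_{ij}$). For a connection $\nabla$ on $T^{1,0}X$ with curvature $\Theta(u,v)=\nabla_u\nabla_v-\nabla_v\nabla_u-\nabla_{[u,v]}$, put $R_{i\bar jk\bar\ell}=g(\Theta(e_i,\bar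 e_j)e_k,\bar e_\ell)$ and $R_{ijk\bar\ell}=g(\Theta(e_i,e_j)e_k,\bar e_\ell)$, and write ${}^tR$ and ${}^cR$ for ${}^t\nabla$ and ${}^c\nabla$. Let ${}^cT(u,v)={}^c\nabla_uv-{}^c\nabla_vu-[u,v]$ for $u,v\in T^{1,0}X$ be the Chern torsion, with components ${}^cT_{ij}^k=g({}^cT(e_i,e_j),\bar e_k)$ and covariant derivatives ${}^cT_{ik,j}^\ell=g(({}^c\nabla_{e_j}{}^cT)(e_i,e_k),\bar e_\ell)$. Then, for all $1\le i,j,k,\ell\le n$, at every point where the frame is defined (summing over $r$ from $1$ to $n$), $${}^tR_{i\bar jk\bar\ell}=t\,{}^cR_{i\bar jk\bar\ell}+\tfrac{1-t}{2}\left({}^cR_{k\bar ji\bar\ell}+{}^cR_{i\bar\ell k\bar j}\right)+\left(\tfrac{1-t}{2}\right)^2\left({}^cT_{ik}^r\overline{{}^cT_{j\ell}^r}-{}^cT_{ir}^\ell\overline{{}^cT_{jr}^k}\right),$$ $${}^tR_{ijk\bar\ell}=\tfrac{1-t}{2}\left({}^cT_{ik,j}^\ell-{}^cT_{jk,i}^\ell\right)+\left(\tfrac{1-t}{2}\right)^2\left({}^cT_{jk}^r\,{}^cT_{ir}^\ell-{}^cT_{ik}^r\,{}^cT_{jr}^\ell\right)-\tfrac{1-t}{2}\,{}^cT_{ij}^r\,{}^cT_{rk}^\ell.$$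 -/

import Mathlib

open scoped Manifold ContDiff TensorProduct Bundle

noncomputable section

namespace HermitianGeometry

section ComplexManifold

variable {E : Type*} [NormedAddCommGroup E] [NormedSpace ℂ E]
  {X : Type*} [TopologicalSpace X] [ChartedSpace E X]

/-- The smooth manifold underlying a complex manifold. -/
instance isManifold_real [IsManifold 𝓘(ℂ, E) ω X] : IsManifold 𝓘(ℝ, E) ∞ X := by
  refine isManifold_of_contDiffOn 𝓘(ℝ, E) ∞ X fun e e' he he' => ?_
  have h := ((contDiffGroupoid ω 𝓘(ℂ, E)).compatible he he').1
  have h1 : ContDiffOn ℂ ω (e.symm.trans e') (e.symm.trans e').source := by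
    simpa [contDiffPregroupoid] using h
  simpa using (h1.restrict_scalars ℝ).of_le le_top

variable (E)

/-- The real tangent space `T_x X`. -/
abbrev RT (x : X) : Type _ := TangentSpace 𝓘(ℝ, E) x

/-- The complexified tangent space `T_x X ⊗ ℂ`. -/
abbrev CT (x : X) : Type _ := ℂ ⊗[ℝ] RT E x

/-- The complex structure on the real tangent space. The space `T_x X` is a copy of `E`, through the
differential of the preferred holomorphic chart at `x`; the complex structure is multiplication by
`√-1` there (any other holomorphic chart gives the same map, since transition maps have complex
linear differentials). -/
def J (x : X) : RT E x →ₗ[ℝ] RT E x :=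
  ((Complex.I • (LinearMap.id : E →ₗ[ℂ] E)).restrictScalars ℝ : E →ₗ[ℝ] E)

lemma J_J (x : X) (v : RT E x) : J E x (J E x v) = -v := by
  have h (w : E) : Complex.I • Complex.I • w = -w := by
    rw [smul_smul, Complex.I_mul_I, neg_one_smul]
  exact h v

/-- The complex-linear extension of the complex structure to `T_x X ⊗ ℂ`. -/
def JC (x : X) : CT E x →ₗ[ℂ] CT E x := (J E x).baseChange ℂ

lemma JC_JC (x : X) (Z : CT E x) : JC E x (JC E x Z) = -Z := by
  induction Z using TensorProduct.induction_on with
  | zero => simp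
  | add a b ha hb => rw [map_add, map_add, ha, hb, neg_add]
  | tmul c v => simp [JC, J_J, TensorProduct.tmul_neg]

variable {E}

/-- The inclusion of real tangent vectors into complex ones. -/
def ofReal (x : X) : RT E x →ₗ[ℝ] CT E x := TensorProduct.mk ℝ ℂ (RT E x) 1

/-- The real part of a complex tangent vector. -/
def re (x : X) : CT E x →ₗ[ℝ] RT E x :=
  (TensorProduct.lid ℝ (RT E x)).toLinearMap ∘ₗ LinearMap.rTensor (RT E x) Complex.reLm

/-- The imaginary part of a complex tangent vector. -/
def im (x : X) : CT E x →ₗ[ℝ] RT E x :=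
  (TensorProduct.lid ℝ (RT E x)).toLinearMap ∘ₗ LinearMap.rTensor (RT E x) Complex.imLm

/-- Complex conjugation on `T_x X ⊗ ℂ`. -/
def conj (x : X) : CT E x →ₗ[ℝ] CT E x :=
  LinearMap.rTensor (RT E x) Complex.conjAe.toLinearMap

variable (E) in
/-- The holomorphic tangent space `T^{1,0}_x X`: the `√-1`-eigenspace of the complex structure. -/
def T10 (x : X) : Submodule ℂ (CT E x) := Module.End.eigenspace (JC E x) Complex.I

/-- The projection of `T_x X ⊗ ℂ = T^{1,0}_x X ⊕ T^{0,1}_x X` onto `T^{1,0}_x X`. -/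
def proj10 (x : X) : CT E x →ₗ[ℂ] T10 E x :=
  LinearMap.codRestrict (T10 E x) ((1 / 2 : ℂ) • (LinearMap.id - Complex.I • JC E x)) (by
    intro Z
    rw [T10, Module.End.mem_eigenspace_iff]
    simp only [LinearMap.smul_apply, LinearMap.sub_apply, LinearMap.id_apply, map_smul, map_sub,
      JC_JC, smul_sub, smul_neg, smul_smul]
    rw [show Complex.I * (1 / 2 * Complex.I) = -(1 / 2) by
      linear_combination (1 / 2 : ℂ) * Complex.I_mul_I, mul_comm Complex.I (1 / 2 : ℂ)]
    simp only [neg_smul]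
    abel)

/-! ### Complex vector fields -/

/-- The complex vector field underlying a section of `T^{1,0}X`. -/
def toCT (W : Π x : X, T10 E x) (x : X) : CT E x := W x

/-- The conjugate of a section of `T^{1,0}X`, a complex vector field of type `(0,1)`. -/
def bar (W : Π x : X, T10 E x) (x : X) : CT E x := conj x (W x)

/-- Real differentiability at `x` of a section of `T^{1,0}X`. -/
def DiffAt [IsManifold 𝓘(ℂ, E) ω X] (W : Π x : X, T10 E x) (x : X) : Prop :=
  MDifferentiableAt 𝓘(ℝ, E) 𝓘(ℝ, E).tangent
      (fun y => (⟨y, re y (W y)⟩ : TangentBundle 𝓘(ℝ, E) X)) x ∧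
    MDifferentiableAt 𝓘(ℝ, E) 𝓘(ℝ, E).tangent
      (fun y => (⟨y, im y (W y)⟩ : TangentBundle 𝓘(ℝ, E) X)) x

/-- Smoothness on `U` of a complex vector field. -/
def SmoothOn [IsManifold 𝓘(ℂ, E) ω X] (Z : Π x : X, CT E x) (U : Set X) : Prop :=
  ContMDiffOn 𝓘(ℝ, E) 𝓘(ℝ, E).tangent ∞
      (fun y => (⟨y, re y (Z y)⟩ : TangentBundle 𝓘(ℝ, E) X)) U ∧
    ContMDiffOn 𝓘(ℝ, E) 𝓘(ℝ, E).tangent ∞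
      (fun y => (⟨y, im y (Z y)⟩ : TangentBundle 𝓘(ℝ, E) X)) U

/-- The derivative of a complex valued function along complex tangent vectors. -/
def dC (f : X → ℂ) (x : X) : CT E x →ₗ[ℂ] ℂ :=
  LinearMap.liftBaseChange ℂ (mvfderiv 𝓘(ℝ, E) f x).toLinearMap

/-- The complex bilinear extension of the Lie bracket of vector fields. -/
def bracket (Z W : Π x : X, CT E x) (x : X) : CT E x :=
  let a : Π x : X, RT E x := fun y => re y (Z y)
  let b : Π x : X, RT E x := fun y => im y (Z y)
  let c : Π x : X, RT E x := fun y => re y (W y)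
  let d : Π x : X, RT E x := fun y => im y (W y)
  ofReal x (VectorField.mlieBracket 𝓘(ℝ, E) a c x - VectorField.mlieBracket 𝓘(ℝ, E) b d x) +
    Complex.I •
      ofReal x (VectorField.mlieBracket 𝓘(ℝ, E) a d x + VectorField.mlieBracket 𝓘(ℝ, E) b c x)

/-! ### Connections on `T^{1,0}X` -/

variable (E X) in
/-- The type of operators `∇` on sections of `T^{1,0}X`; `∇ W x Z` stands for `(∇_Z W)(x)`. -/
abbrev T10Operator : Type _ := (Π x : X, T10 E x) → Π x : X, CT E x →ₗ[ℂ] T10 E x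

/-- The section `∇_Z W` of `T^{1,0}X`. -/
def cov (D : T10Operator E X) (Z : Π x : X, CT E x) (W : Π x : X, T10 E x) (x : X) : T10 E x :=
  D W x (Z x)

/-- A (smooth, complex-linear) connection on the complex vector bundle `T^{1,0}X`. The value of the
operator on a section at a point where that section is not differentiable is unconstrained. -/
structure IsConnection [IsManifold 𝓘(ℂ, E) ω X] (D : T10Operator E X) : Prop where
  add {V W : Π x : X, T10 E x} {x : X} (hV : DiffAt V x) (hW : DiffAt W x) :
    D (fun y => V y + W y) x = D V x + D W x
  leibniz {f : X → ℂ} {W : Π x : X, T10 E x} {x : X}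
    (hf : MDifferentiableAt 𝓘(ℝ, E) 𝓘(ℝ, ℂ) f x) (hW : DiffAt W x) (Z : CT E x) :
    D (fun y => f y • W y) x Z = dC f x Z • W x + f x • D W x Z
  smooth {U : Set X} (hU : IsOpen U) {Z : Π x : X, CT E x} {W : Π x : X, T10 E x}
    (hZ : SmoothOn Z U) (hW : SmoothOn (toCT W) U) : SmoothOn (toCT (cov D Z W)) U

/-- The Cauchy-Riemann operator of the holomorphic vector bundle `T^{1,0}X`, evaluated on the
conjugate of `V ∈ T^{1,0}X`: it is `[V̄, W]^{1,0}`. -/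
def dbar (V W : Π x : X, T10 E x) (x : X) : T10 E x := proj10 x (bracket (bar V) (toCT W) x)

/-- The curvature `Θ(Z, W) V = ∇_Z ∇_W V - ∇_W ∇_Z V - ∇_{[Z, W]} V`. -/
def curvature (D : T10Operator E X) (Z W : Π x : X, CT E x) (V : Π x : X, T10 E x) (x : X) :
    T10 E x :=
  cov D Z (cov D W V) x - cov D W (cov D Z V) x - cov D (bracket Z W) V x

/-- The torsion `T(V, W) = ∇_V W - ∇_W V - [V, W]` on sections of `T^{1,0}X`. On a complex manifold
`[V, W]` is again of type `(1,0)`. -/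
def torsion (D : T10Operator E X) (V W : Π x : X, T10 E x) (x : X) : T10 E x :=
  cov D (toCT V) W x - cov D (toCT W) V x - proj10 x (bracket (toCT V) (toCT W) x)

/-- The covariant derivative `(∇_Z T)(V, W)` of the torsion. -/
def torsionDeriv (D : T10Operator E X) (Z : Π x : X, CT E x) (V W : Π x : X, T10 E x) (x : X) :
    T10 E x :=
  cov D Z (torsion D V W) x - torsion D (cov D Z V) W x - torsion D V (cov D Z W) x

end ComplexManifold

/-! ### Hermitian metrics -/

section Metric

variable {E : Type*} [NormedAddCommGroup E] [NormedSpace ℂ E]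
  {X : Type*} [TopologicalSpace X] [ChartedSpace E X]
  [Bundle.RiemannianBundle (fun x : X => TangentSpace 𝓘(ℝ, E) x)]

variable (E X) in
/-- The Riemannian metric is compatible with the complex structure: `g(Ju, Jv) = g(u, v)`. -/
def IsHermitianMetric : Prop :=
  ∀ (x : X) (u v : RT E x), inner ℝ (J E x u) (J E x v) = inner ℝ u v

/-- The complex bilinear extension of the Riemannian metric to `T_x X ⊗ ℂ`. -/
def gC (x : X) : CT E x →ₗ[ℂ] CT E x →ₗ[ℂ] ℂ :=
  LinearMap.BilinForm.baseChange ℂ (innerₗ (RT E x))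

/-- The Hermitian metric `h(V, W) = g(V, W̄)` on `T^{1,0}X`. -/
def herm (V W : Π x : X, T10 E x) (x : X) : ℂ := gC x (V x : CT E x) (bar W x)

/-- The connection preserves the Hermitian metric:
`Z h(V, W) = h(∇_Z V, W) + h(V, ∇_{Z̄} W)`. -/
def PreservesMetric [IsManifold 𝓘(ℂ, E) ω X] (D : T10Operator E X) : Prop :=
  ∀ (V W : Π x : X, T10 E x) (x : X), DiffAt V x → DiffAt W x → ∀ Z : CT E x,
    dC (herm V W) x Z =
      gC x (D V x Z : CT E x) (conj x (W x)) + gC x (V x : CT E x) (conj x (D W x (conj x Z)))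

/-- The Chern connection: the Hermitian connection on `T^{1,0}X` whose `(0,1)`-part is the
Cauchy-Riemann operator of `T^{1,0}X`. -/
structure IsChernConnection [IsManifold 𝓘(ℂ, E) ω X] (D : T10Operator E X) : Prop where
  isConnection : IsConnection D
  hermitian : PreservesMetric D
  complexAnalytic : ∀ (V W : Π x : X, T10 E x) (x : X), DiffAt V x → DiffAt W x →
    cov D (bar V) W x = dbar V W x

/-- The Levi-Civita connection: the torsion-free connection on the real tangent bundle which
preserves the metric, `v g(Y, Z) = g(∇_v Y, Z) + g(Y, ∇_v Z)`. -/
structure IsLeviCivita [FiniteDimensional ℂ E] [IsManifold 𝓘(ℂ, E) ω X]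
    (L : CovariantDerivative 𝓘(ℝ, E) E (fun x : X => TangentSpace 𝓘(ℝ, E) x)) : Prop where
  torsionFree : L.torsion = 0
  metric (Y Z : Π x : X, TangentSpace 𝓘(ℝ, E) x) (x : X)
    (hY : MDifferentiableAt 𝓘(ℝ, E) 𝓘(ℝ, E).tangent
      (fun y => (⟨y, Y y⟩ : TangentBundle 𝓘(ℝ, E) X)) x)
    (hZ : MDifferentiableAt 𝓘(ℝ, E) 𝓘(ℝ, E).tangent
      (fun y => (⟨y, Z y⟩ : TangentBundle 𝓘(ℝ, E) X)) x)
    (v : TangentSpace 𝓘(ℝ, E) x) :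
    mvfderiv 𝓘(ℝ, E) (fun y => inner ℝ (Y y) (Z y)) x v =
      inner ℝ (L Y x v) (Z x) + inner ℝ (Y x) (L Z x v)

end Metric

section Gauduchon

variable {E : Type*} [NormedAddCommGroup E] [NormedSpace ℂ E]
  {X : Type*} [TopologicalSpace X] [ChartedSpace E X] [IsManifold 𝓘(ℂ, E) ω X]

/-- The Lichnerowicz connection: the complex-linear extension of the Levi-Civita connection `L`,
restricted to sections of `T^{1,0}X` and followed by the projection onto `T^{1,0}X`. -/
def lichnerowicz (L : CovariantDerivative 𝓘(ℝ, E) E (fun x : X => TangentSpace 𝓘(ℝ, E) x)) :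
    T10Operator E X := fun W x =>
  proj10 x ∘ₗ LinearMap.liftBaseChange ℂ
    (ofReal x ∘ₗ (L (fun y => re y (W y : CT E y)) x).toLinearMap +
      Complex.I • (ofReal x ∘ₗ (L (fun y => im y (W y : CT E y)) x).toLinearMap))

/-- The `t`-Gauduchon connection `t ᶜ∇ + (1 - t) ˡ∇`, where `C` is the Chern connection and `L` the
Levi-Civita connection. -/
def gauduchon (C : T10Operator E X)
    (L : CovariantDerivative 𝓘(ℝ, E) E (fun x : X => TangentSpace 𝓘(ℝ, E) x)) (t : ℝ) :
    T10Operator E X := fun W x =>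
  (t : ℂ) • C W x + (1 - (t : ℂ)) • lichnerowicz L W x

end Gauduchon

/-! ### Components in a unitary frame -/

section Frame

variable {E : Type*} [NormedAddCommGroup E] [NormedSpace ℂ E]
  {X : Type*} [TopologicalSpace X] [ChartedSpace E X]
  [Bundle.RiemannianBundle (fun x : X => TangentSpace 𝓘(ℝ, E) x)] {n : ℕ}

/-- `e 0, …, e (n - 1)` is a smooth unitary frame of `T^{1,0}X` over `U`. -/
structure IsUnitaryFrameOn [IsManifold 𝓘(ℂ, E) ω X] (e : Fin n → Π x : X, T10 E x) (U : Set X) :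
    Prop where
  smooth (i : Fin n) : SmoothOn (toCT (e i)) U
  unitary {x : X} (hx : x ∈ U) (i j : Fin n) : herm (e i) (e j) x = if i = j then 1 else 0
  span {x : X} (hx : x ∈ U) : Submodule.span ℂ (Set.range fun i => e i x) = ⊤

/-- The component `R_{i j̄ k l̄} = g(Θ(e_i, ē_j) e_k, ē_l)`. -/
def R11 (D : T10Operator E X) (e : Fin n → Π x : X, T10 E x) (x : X) (i j k l : Fin n) : ℂ :=
  herm (curvature D (toCT (e i)) (bar (e j)) (e k)) (e l) x

/-- The component `R_{i j k l̄} = g(Θ(e_i, e_j) e_k, ē_l)`. -/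
def R20 (D : T10Operator E X) (e : Fin n → Π x : X, T10 E x) (x : X) (i j k l : Fin n) : ℂ :=
  herm (curvature D (toCT (e i)) (toCT (e j)) (e k)) (e l) x

/-- The component `T_{ij}^k = g(T(e_i, e_j), ē_k)` of the torsion. -/
def tors (D : T10Operator E X) (e : Fin n → Π x : X, T10 E x) (x : X) (i j k : Fin n) : ℂ :=
  herm (torsion D (e i) (e j)) (e k) x

/-- The component `T_{ik,j}^l = g((∇_{e_j} T)(e_i, e_k), ē_l)` of the covariant derivative of the
torsion; the arguments are in the order `i k l j`. -/
def torsDeriv (D : T10Operator E X) (e : Fin n → Π x : X, T10 E x) (x : X) (i k l j : Fin n) : ℂ :=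
  herm (torsionDeriv D (toCT (e j)) (e i) (e k)) (e l) x

end Frame

end HermitianGeometry

end

open HermitianGeometry

/-! Write h(v,w) = g(v,w̄), s = (1-t)/2 and let A be twice the difference of the Chern and
Lichnerowicz connections (`chernDefect`), so that the t-Gauduchon connection is C - sA. Everything
rests on expressing A through the Chern torsion T, for u, v, w of type (1,0): A_u v = T(u,v) and
h(A_ū v, w) = -h(v, T(u,w)). Both come from a Koszul argument (`gC_chernDefect_toCT`,
`gC_chernDefect_bar`): g-compatibility of the two connections, vanishing torsion of Levi-Civita, and
isotropy of T^{1,0} and T^{0,1} for the bilinear metric.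

Expanding the curvature of C - sA gives the Chern curvature, a term linear in s built from Chern
derivatives of A, and a term s²[A,A]. Once the bracket is split by means of the Chern connection,
the linear term consists of covariant derivatives of T, plus T(T(·,·),·) in the (2,0) case.

For two (1,0) directions the Chern curvature vanishes: its (0,2)-part is zero by the Jacobi identity
and integrability, and the curvature of a metric connection is skew-Hermitian. For mixed directions,
the first Bianchi identity `torsionDeriv_bar` turns each derivative of T along a (0,1) vector into a
difference of two Chern curvatures. Two such terms occur, each contributing -s times the original
curvature, whose coefficient becomes 1 - 2s = t. -/

noncomputable section

open scoped Topology

namespace HermitianGeometry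

/-! ### Linear algebra of the complexified tangent space -/

section Pointwise

variable {E : Type*} [NormedAddCommGroup E] [NormedSpace ℂ E]
  {X : Type*} [TopologicalSpace X] [ChartedSpace E X] {x : X}

@[simp] lemma re_tmul (c : ℂ) (v : RT E x) : re x (c ⊗ₜ v) = c.re • v := by simp [re]

@[simp] lemma im_tmul (c : ℂ) (v : RT E x) : im x (c ⊗ₜ v) = c.im • v := by simp [im]

@[simp] lemma conj_tmul (c : ℂ) (v : RT E x) :
    conj x (c ⊗ₜ v) = (starRingEnd ℂ c) ⊗ₜ v := by simp [conj]

@[simp] lemma re_ofReal (v : RT E x) : re x (ofReal x v) = v := by simp [ofReal]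

@[simp] lemma im_ofReal (v : RT E x) : im x (ofReal x v) = 0 := by simp [ofReal]

lemma re_smul (c : ℂ) (Z : CT E x) : re x (c • Z) = c.re • re x Z - c.im • im x Z := by
  induction Z using TensorProduct.induction_on with
  | zero => simp
  | add a b ha hb => rw [smul_add, map_add, ha, hb, map_add, map_add]; module
  | tmul d v => rw [TensorProduct.smul_tmul', re_tmul, re_tmul, im_tmul, smul_eq_mul,
      Complex.mul_re]; module

lemma im_smul (c : ℂ) (Z : CT E x) : im x (c • Z) = c.re • im x Z + c.im • re x Z := by
  induction Z using TensorProduct.induction_on with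
  | zero => simp
  | add a b ha hb => rw [smul_add, map_add, ha, hb, map_add, map_add]; module
  | tmul d v => rw [TensorProduct.smul_tmul', im_tmul, re_tmul, im_tmul, smul_eq_mul,
      Complex.mul_im]; module

lemma ofReal_re_add_im (Z : CT E x) :
    ofReal x (re x Z) + Complex.I • ofReal x (im x Z) = Z := by
  induction Z using TensorProduct.induction_on with
  | zero => simp
  | add a b ha hb =>
    nth_rw 3 [← ha, ← hb]
    simp only [map_add, smul_add]; abel
  | tmul d v =>
    simp only [ofReal, re_tmul, im_tmul, TensorProduct.mk_apply, TensorProduct.smul_tmul',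
      ← TensorProduct.smul_tmul, ← TensorProduct.add_tmul]
    congr 1
    apply Complex.ext <;> simp

lemma ext_re_im {Z W : CT E x} (h : re x Z = re x W) (h' : im x Z = im x W) : Z = W := by
  rw [← ofReal_re_add_im Z, ← ofReal_re_add_im W, h, h']

@[simp] lemma re_conj (Z : CT E x) : re x (conj x Z) = re x Z := by
  induction Z using TensorProduct.induction_on with
  | zero => simp
  | add a b ha hb => simp only [map_add, ha, hb]
  | tmul d v => simp

@[simp] lemma im_conj (Z : CT E x) : im x (conj x Z) = -im x Z := by
  induction Z using TensorProduct.induction_on with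
  | zero => simp
  | add a b ha hb => simp only [map_add, ha, hb, neg_add]
  | tmul d v => simp

@[simp] lemma conj_conj (Z : CT E x) : conj x (conj x Z) = Z := ext_re_im (by simp) (by simp)

lemma re_JC (Z : CT E x) : re x (JC E x Z) = J E x (re x Z) := by
  induction Z using TensorProduct.induction_on with
  | zero => simp
  | add a b ha hb => simp only [map_add, ha, hb]
  | tmul d v => simp [JC]

lemma im_JC (Z : CT E x) : im x (JC E x Z) = J E x (im x Z) := by
  induction Z using TensorProduct.induction_on with
  | zero => simp
  | add a b ha hb => simp only [map_add, ha, hb]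
  | tmul d v => simp [JC]

/-- Vectors of type (1,0) are those of the form v - √-1 Jv. In this form statements about types
reduce to statements about real fields. -/
lemma mem_T10_iff {Z : CT E x} : Z ∈ T10 E x ↔ im x Z = -J E x (re x Z) := by
  rw [T10, Module.End.mem_eigenspace_iff]
  constructor
  · intro h
    have := congrArg (re x) h
    rw [re_JC, re_smul] at this
    simp only [Complex.I_re, Complex.I_im, zero_smul, one_smul, zero_sub] at this
    rw [this, neg_neg]
  · intro h
    refine ext_re_im ?_ ?_
    · rw [re_JC, re_smul, h]; simp
    · rw [im_JC, im_smul, h, map_neg, J_J]; simp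

lemma im_eq_of_T10 (Z : T10 E x) : im x (Z : CT E x) = -J E x (re x Z) := mem_T10_iff.1 Z.2

lemma coe_proj10 (Z : CT E x) :
    (proj10 x Z : CT E x) = (1 / 2 : ℂ) • (Z - Complex.I • JC E x Z) := rfl

lemma proj10_of_mem {Z : CT E x} (h : Z ∈ T10 E x) : (proj10 x Z : CT E x) = Z := by
  have h' := Module.End.mem_eigenspace_iff.1 h
  rw [coe_proj10, h', smul_smul, Complex.I_mul_I]
  module

lemma proj10_conj (Z : T10 E x) : proj10 x (conj x (Z : CT E x)) = 0 := by
  apply Subtype.ext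
  rw [coe_proj10]
  have h := im_eq_of_T10 Z
  refine ext_re_im ?_ ?_
  · simp [re_smul, re_JC, im_JC, h, J_J]
  · simp [im_smul, re_smul, re_JC, im_JC, h]

/-- The (0,1)-part of Z is the conjugate of the (1,0)-part of Z̄, so the type decomposition needs no
separate space T^{0,1}. -/
lemma conj_proj10_conj_mem_add (Z : CT E x) :
    (proj10 x Z : CT E x) + conj x (proj10 x (conj x Z)) = Z := by
  rw [coe_proj10, coe_proj10]
  refine ext_re_im ?_ ?_ <;> simp [re_smul, im_smul, re_JC, im_JC] <;> module

end Pointwise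

/-! ### Complexified Lie bracket and differentiability of complex fields -/

section Brackets

variable {E : Type*} [NormedAddCommGroup E] [NormedSpace ℂ E]
  {X : Type*} [TopologicalSpace X] [ChartedSpace E X] {x : X}

lemma re_bracket (Z W : Π x : X, CT E x) (x : X) :
    re x (bracket Z W x) =
      VectorField.mlieBracket 𝓘(ℝ, E) (fun y => re y (Z y)) (fun y => re y (W y)) x -
      VectorField.mlieBracket 𝓘(ℝ, E) (fun y => im y (Z y)) (fun y => im y (W y)) x := by
  simp [bracket, re_smul]

lemma im_bracket (Z W : Π x : X, CT E x) (x : X) :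
    im x (bracket Z W x) =
      VectorField.mlieBracket 𝓘(ℝ, E) (fun y => re y (Z y)) (fun y => im y (W y)) x +
      VectorField.mlieBracket 𝓘(ℝ, E) (fun y => im y (Z y)) (fun y => re y (W y)) x := by
  simp [bracket, im_smul]

lemma bracket_swap (Z W : Π x : X, CT E x) (x : X) : bracket Z W x = -bracket W Z x := by
  refine ext_re_im ?_ ?_
  · rw [map_neg, re_bracket, re_bracket, VectorField.mlieBracket_swap_apply,
      VectorField.mlieBracket_swap_apply (V := fun y => im y (Z y))]; abel
  · rw [map_neg, im_bracket, im_bracket, VectorField.mlieBracket_swap_apply,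
      VectorField.mlieBracket_swap_apply (V := fun y => im y (Z y))]; abel

lemma bracket_congr {Z Z' W W' : Π x : X, CT E x} (hZ : ∀ᶠ y in 𝓝 x, Z y = Z' y)
    (hW : ∀ᶠ y in 𝓝 x, W y = W' y) : bracket Z W x = bracket Z' W' x := by
  have h1 : (fun y => re y (Z y)) =ᶠ[𝓝 x] fun y => re y (Z' y) :=
    hZ.mono fun y hy => congrArg (re y) hy
  have h2 : (fun y => im y (Z y)) =ᶠ[𝓝 x] fun y => im y (Z' y) :=
    hZ.mono fun y hy => congrArg (im y) hy
  have h3 : (fun y => re y (W y)) =ᶠ[𝓝 x] fun y => re y (W' y) :=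
    hW.mono fun y hy => congrArg (re y) hy
  have h4 : (fun y => im y (W y)) =ᶠ[𝓝 x] fun y => im y (W' y) :=
    hW.mono fun y hy => congrArg (im y) hy
  refine ext_re_im ?_ ?_
  · rw [re_bracket, re_bracket, h1.mlieBracket_vectorField_eq h3, h2.mlieBracket_vectorField_eq h4]
  · rw [im_bracket, im_bracket, h1.mlieBracket_vectorField_eq h4, h2.mlieBracket_vectorField_eq h3]

/-- Real differentiability at `x` of a complex vector field. -/
def CDiffAt [IsManifold 𝓘(ℂ, E) ω X] (Z : Π x : X, CT E x) (x : X) : Prop :=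
  MDifferentiableAt 𝓘(ℝ, E) 𝓘(ℝ, E).tangent
      (fun y => (⟨y, re y (Z y)⟩ : TangentBundle 𝓘(ℝ, E) X)) x ∧
    MDifferentiableAt 𝓘(ℝ, E) 𝓘(ℝ, E).tangent
      (fun y => (⟨y, im y (Z y)⟩ : TangentBundle 𝓘(ℝ, E) X)) x

variable [IsManifold 𝓘(ℂ, E) ω X]

lemma CDiffAt.congr {Z W : Π x : X, CT E x} (h : CDiffAt Z x) (hZW : ∀ᶠ y in 𝓝 x, Z y = W y) :
    CDiffAt W x :=
  ⟨h.1.congr_of_eventuallyEq (hZW.mono fun y hy => by simp only [hy]),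
    h.2.congr_of_eventuallyEq (hZW.mono fun y hy => by simp only [hy])⟩

lemma CDiffAt.add {Z W : Π x : X, CT E x} (hZ : CDiffAt Z x) (hW : CDiffAt W x) :
    CDiffAt (fun y => Z y + W y) x := by
  have h1 := mdifferentiableAt_add_section hZ.1 hW.1
  have h2 := mdifferentiableAt_add_section hZ.2 hW.2
  simp only [CDiffAt, map_add]
  exact ⟨h1, h2⟩

lemma CDiffAt.conj {Z : Π x : X, CT E x} (hZ : CDiffAt Z x) :
    CDiffAt (fun y => conj y (Z y)) x := by
  simp only [CDiffAt, re_conj, im_conj]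
  exact ⟨hZ.1, mdifferentiableAt_neg_section hZ.2⟩

lemma CDiffAt.smul {Z : Π x : X, CT E x} {f : X → ℂ} (hf : MDifferentiableAt 𝓘(ℝ, E) 𝓘(ℝ, ℂ) f x)
    (hZ : CDiffAt Z x) : CDiffAt (fun y => f y • Z y) x := by
  have hre : MDifferentiableAt 𝓘(ℝ, E) 𝓘(ℝ, ℝ) (fun y => (f y).re) x :=
    Complex.reCLM.mdifferentiableAt.comp x hf
  have him : MDifferentiableAt 𝓘(ℝ, E) 𝓘(ℝ, ℝ) (fun y => (f y).im) x :=
    Complex.imCLM.mdifferentiableAt.comp x hf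
  simp only [CDiffAt, re_smul, im_smul]
  exact ⟨mdifferentiableAt_sub_section (hre.smul_section hZ.1) (him.smul_section hZ.2),
    mdifferentiableAt_add_section (hre.smul_section hZ.2) (him.smul_section hZ.1)⟩

end Brackets

/-! ### Vanishing of the Nijenhuis tensor -/

section Integrability

variable {E : Type*} [NormedAddCommGroup E] [NormedSpace ℂ E]
  {X : Type*} [TopologicalSpace X] [ChartedSpace E X] {x : X}

/-- Pullbacks of vector fields use `inverse`, which is 0 on non-invertible maps; complex linearity
survives in both cases. -/
lemma inverse_I_smul {F G : Type*} [NormedAddCommGroup F] [NormedSpace ℂ F] [NormedAddCommGroup G]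
    [NormedSpace ℂ G] (A : F →L[ℝ] G) (hA : ∀ v, A (Complex.I • v) = Complex.I • A v) (w : G) :
    A.inverse (Complex.I • w) = Complex.I • A.inverse w := by
  by_cases h : A.IsInvertible
  · obtain ⟨B, rfl⟩ := h
    simp only [ContinuousLinearMap.inverse_equiv, ContinuousLinearEquiv.coe_coe] at hA ⊢
    rw [ContinuousLinearEquiv.symm_apply_eq, hA, B.apply_symm_apply]
  · simp [ContinuousLinearMap.inverse_of_not_isInvertible h]

/-- The real differential of a holomorphic map is complex linear. -/
lemma exists_mfderiv_eq_restrictScalars {F : Type*} [NormedAddCommGroup F] [NormedSpace ℂ F]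
    {Y : Type*} [TopologicalSpace Y] [ChartedSpace F Y] {f : X → Y}
    (hf : MDifferentiableAt 𝓘(ℂ, E) 𝓘(ℂ, F) f x) :
    ∃ A : E →L[ℂ] F, mfderiv 𝓘(ℝ, E) 𝓘(ℝ, F) f x = A.restrictScalars ℝ := by
  have h := hf.hasMFDerivAt
  refine ⟨mfderiv 𝓘(ℂ, E) 𝓘(ℂ, F) f x, ?_⟩
  have h' : HasMFDerivAt 𝓘(ℝ, E) 𝓘(ℝ, F) f x
      ((mfderiv 𝓘(ℂ, E) 𝓘(ℂ, F) f x : E →L[ℂ] F).restrictScalars ℝ) :=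
    ⟨h.1, HasFDerivWithinAt.restrictScalars ℝ h.2⟩
  exact h'.mfderiv

variable [IsManifold 𝓘(ℂ, E) ω X] [CompleteSpace E]

/-- Integrability of the complex structure of a complex manifold: the Nijenhuis tensor vanishes. -/
lemma mlieBracket_J_J {V W : Π x : X, RT E x}
    (hV : MDifferentiableAt 𝓘(ℝ, E) 𝓘(ℝ, E).tangent
      (fun y => (⟨y, V y⟩ : TangentBundle 𝓘(ℝ, E) X)) x)
    (hW : MDifferentiableAt 𝓘(ℝ, E) 𝓘(ℝ, E).tangent
      (fun y => (⟨y, W y⟩ : TangentBundle 𝓘(ℝ, E) X)) x) :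
    VectorField.mlieBracket 𝓘(ℝ, E) (fun y => J E y (V y)) (fun y => J E y (W y)) x =
      VectorField.mlieBracket 𝓘(ℝ, E) V W x +
      J E x (VectorField.mlieBracket 𝓘(ℝ, E) (fun y => J E y (V y)) W x) +
      J E x (VectorField.mlieBracket 𝓘(ℝ, E) V (fun y => J E y (W y)) x) := by
  have : IsManifold 𝓘(ℂ, E) 1 X := IsManifold.of_le (n := ω) le_top
  set φ := extChartAt 𝓘(ℝ, E) x with hφ
  -- `P V` is the field V read in the preferred chart at x.
  let P (V : Π x : X, RT E x) : E → E :=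
    VectorField.mpullbackWithin 𝓘(ℝ, E) 𝓘(ℝ, E) φ.symm V (Set.range 𝓘(ℝ, E))
  -- The inverse chart is holomorphic, so its differential is complex linear and J becomes the
  -- constant operator √-1 throughout the chart.
  have hP (V : Π x : X, RT E x) :
      P (fun y => J E y (V y)) =ᶠ[𝓝 (φ x)] fun y => Complex.I • P V y := by
    filter_upwards [(isOpen_extChartAt_target (I := 𝓘(ℝ, E)) x).mem_nhds (mem_extChartAt_target x)]
      with y hy
    have hd : MDifferentiableAt 𝓘(ℂ, E) 𝓘(ℂ, E) φ.symm y := by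
      have := mdifferentiableWithinAt_extChartAt_symm (I := 𝓘(ℂ, E)) (x := x) (z := y) hy
      simpa using! this
    obtain ⟨A, hA⟩ := exists_mfderiv_eq_restrictScalars hd
    have hA' : ∀ v : E, @Eq E ((mfderivWithin 𝓘(ℝ, E) 𝓘(ℝ, E) φ.symm (Set.range 𝓘(ℝ, E)) y :)
        (@HSMul.hSMul ℂ E E _ Complex.I v)) (@HSMul.hSMul ℂ E E _ Complex.I
          ((mfderivWithin 𝓘(ℝ, E) 𝓘(ℝ, E) φ.symm (Set.range 𝓘(ℝ, E)) y :) v)) := by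
      rw [ModelWithCorners.range_eq_univ, mfderivWithin_univ, hA]
      exact fun v => A.map_smul Complex.I v
    exact inverse_I_smul (F := E) (G := E)
      (mfderivWithin 𝓘(ℝ, E) 𝓘(ℝ, E) φ.symm (Set.range 𝓘(ℝ, E)) y) hA' (V (φ.symm y))
  let D : E →L[ℝ] E := mfderiv 𝓘(ℝ, E) 𝓘(ℝ, E) φ x
  have hb (V W : Π x : X, RT E x) : @Eq E (VectorField.mlieBracket 𝓘(ℝ, E) V W x)
      (D.inverse (VectorField.lieBracket ℝ (P V) (P W) (φ x))) := by
    rw [← VectorField.mlieBracketWithin_univ, VectorField.mlieBracketWithin_apply]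
    rw [Set.preimage_univ, Set.univ_inter, ← VectorField.lieBracketWithin_univ,
      ← ModelWithCorners.range_eq_univ 𝓘(ℝ, E)]
    rfl
  have hdiff {V : Π x : X, RT E x} (hV : MDifferentiableAt 𝓘(ℝ, E) 𝓘(ℝ, E).tangent
      (fun y => (⟨y, V y⟩ : TangentBundle 𝓘(ℝ, E) X)) x) : DifferentiableAt ℝ (P V) (φ x) := by
    have h : DifferentiableWithinAt ℝ (P V)
        ((extChartAt 𝓘(ℝ, E) x).symm ⁻¹' Set.univ ∩ Set.range 𝓘(ℝ, E)) (φ x) :=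
      (hV.mdifferentiableWithinAt (s := Set.univ)
      ).differentiableWithinAt_mpullbackWithin_vectorField
    rwa [Set.preimage_univ, Set.univ_inter, ModelWithCorners.range_eq_univ,
      differentiableWithinAt_univ] at h
  obtain ⟨B, hB⟩ := exists_mfderiv_eq_restrictScalars (E := E) (F := E) (x := x)
    (mdifferentiableAt_extChartAt (I := 𝓘(ℂ, E)) (x := x) (y := x) (mem_chart_source E x))
  have hD : D = B.restrictScalars ℝ := hB
  have hI := inverse_I_smul D (by rw [hD]; simp)
  -- A constant complex structure commutes with differentiation; the identity in the chart is then
  -- pure algebra in the formula for the flat bracket.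
  have hIP {V : Π x : X, RT E x} (hV : DifferentiableAt ℝ (P V) (φ x)) (v : E) :
      fderiv ℝ (P fun y => J E y (V y)) (φ x) v = Complex.I • fderiv ℝ (P V) (φ x) v := by
    rw [(hP V).fderiv_eq]
    exact congrArg (fun A : E →L[ℝ] E => A v) (fderiv_const_smul hV Complex.I)
  have key : ∀ a b c d : E, a = b + Complex.I • c + Complex.I • d →
    D.inverse a = D.inverse b + Complex.I • D.inverse c + Complex.I • D.inverse d := by
    rintro _ b c d rfl
    rw [map_add, map_add, hI, hI]
  have hfin := key
    (VectorField.lieBracket ℝ (P fun y => J E y (V y)) (P fun y => J E y (W y)) (φ x))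
    (VectorField.lieBracket ℝ (P V) (P W) (φ x))
    (VectorField.lieBracket ℝ (P fun y => J E y (V y)) (P W) (φ x))
    (VectorField.lieBracket ℝ (P V) (P fun y => J E y (W y)) (φ x)) (by
      simp only [VectorField.lieBracket, hIP (hdiff hV), hIP (hdiff hW), (hP V).self_of_nhds,
        (hP W).self_of_nhds, smul_sub, smul_smul, Complex.I_mul_I]
      module)
  rw [← hb, ← hb, ← hb, ← hb] at hfin
  exact hfin

end Integrability

/-! ### Types of brackets, smoothness and the Jacobi identity -/

section BracketAlgebra

variable {E : Type*} [NormedAddCommGroup E] [NormedSpace ℂ E]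
  {X : Type*} [TopologicalSpace X] [ChartedSpace E X] [IsManifold 𝓘(ℂ, E) ω X] {x : X}

lemma DiffAt.toCT {W : Π x : X, T10 E x} (h : DiffAt W x) : CDiffAt (toCT W) x := h

lemma DiffAt.bar {W : Π x : X, T10 E x} (h : DiffAt W x) : CDiffAt (bar W) x := h.toCT.conj

lemma SmoothOn.cdiffAt {Z : Π x : X, CT E x} {U : Set X} (h : SmoothOn Z U) (hU : IsOpen U)
    (hx : x ∈ U) : CDiffAt Z x :=
  ⟨(h.1.contMDiffAt (hU.mem_nhds hx)).mdifferentiableAt (by simp),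
    (h.2.contMDiffAt (hU.mem_nhds hx)).mdifferentiableAt (by simp)⟩

lemma SmoothOn.diffAt {W : Π x : X, T10 E x} {U : Set X} (h : SmoothOn (toCT W) U) (hU : IsOpen U)
    (hx : x ∈ U) : DiffAt W x := h.cdiffAt hU hx

lemma SmoothOn.congr {Z W : Π x : X, CT E x} {U : Set X} (h : SmoothOn Z U)
    (hZW : ∀ y ∈ U, W y = Z y) : SmoothOn W U :=
  ⟨h.1.congr fun y hy => by simp only [hZW y hy], h.2.congr fun y hy => by simp only [hZW y hy]⟩

lemma SmoothOn.conj {Z : Π x : X, CT E x} {U : Set X} (h : SmoothOn Z U) :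
    SmoothOn (fun y => conj y (Z y)) U := by
  simp only [SmoothOn, re_conj, im_conj]
  exact ⟨h.1, h.2.neg_section⟩

lemma SmoothOn.bar {W : Π x : X, T10 E x} {U : Set X} (h : SmoothOn (toCT W) U) :
    SmoothOn (bar W) U := h.conj

lemma SmoothOn.sub {Z W : Π x : X, CT E x} {U : Set X} (hZ : SmoothOn Z U) (hW : SmoothOn W U) :
    SmoothOn (fun y => Z y - W y) U := by
  simp only [SmoothOn, map_sub]
  exact ⟨hZ.1.sub_section hW.1, hZ.2.sub_section hW.2⟩

variable [CompleteSpace E]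

lemma mlieBracket_neg_right {V W : Π x : X, RT E x}
    (hW : MDifferentiableAt 𝓘(ℝ, E) 𝓘(ℝ, E).tangent
      (fun y => (⟨y, W y⟩ : TangentBundle 𝓘(ℝ, E) X)) x) :
    VectorField.mlieBracket 𝓘(ℝ, E) V (fun y => -W y) x =
      -VectorField.mlieBracket 𝓘(ℝ, E) V W x := by
  have h := VectorField.mlieBracket_const_smul_right (c := (-1 : ℝ)) (V := V) hW
  rw [neg_one_smul, neg_one_smul] at h
  exact h

lemma mlieBracket_neg_left {V W : Π x : X, RT E x}
    (hV : MDifferentiableAt 𝓘(ℝ, E) 𝓘(ℝ, E).tangent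
      (fun y => (⟨y, V y⟩ : TangentBundle 𝓘(ℝ, E) X)) x) :
    VectorField.mlieBracket 𝓘(ℝ, E) (fun y => -V y) W x =
      -VectorField.mlieBracket 𝓘(ℝ, E) V W x := by
  have h := VectorField.mlieBracket_const_smul_left (c := (-1 : ℝ)) (W := W) hV
  rw [neg_one_smul, neg_one_smul] at h
  exact h

lemma mlieBracket_sub_right {V W W' : Π x : X, RT E x}
    (hW : MDifferentiableAt 𝓘(ℝ, E) 𝓘(ℝ, E).tangent
      (fun y => (⟨y, W y⟩ : TangentBundle 𝓘(ℝ, E) X)) x)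
    (hW' : MDifferentiableAt 𝓘(ℝ, E) 𝓘(ℝ, E).tangent
      (fun y => (⟨y, W' y⟩ : TangentBundle 𝓘(ℝ, E) X)) x) :
    VectorField.mlieBracket 𝓘(ℝ, E) V (fun y => W y - W' y) x =
      VectorField.mlieBracket 𝓘(ℝ, E) V W x - VectorField.mlieBracket 𝓘(ℝ, E) V W' x := by
  simp only [sub_eq_add_neg]
  rw [← mlieBracket_neg_right hW']
  exact VectorField.mlieBracket_add_right hW (mdifferentiableAt_neg_section hW')

lemma mlieBracket_add_right' {V W W' : Π x : X, RT E x}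
    (hW : MDifferentiableAt 𝓘(ℝ, E) 𝓘(ℝ, E).tangent
      (fun y => (⟨y, W y⟩ : TangentBundle 𝓘(ℝ, E) X)) x)
    (hW' : MDifferentiableAt 𝓘(ℝ, E) 𝓘(ℝ, E).tangent
      (fun y => (⟨y, W' y⟩ : TangentBundle 𝓘(ℝ, E) X)) x) :
    VectorField.mlieBracket 𝓘(ℝ, E) V (fun y => W y + W' y) x =
      VectorField.mlieBracket 𝓘(ℝ, E) V W x + VectorField.mlieBracket 𝓘(ℝ, E) V W' x :=
  VectorField.mlieBracket_add_right hW hW'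

lemma bracket_add_right {Z W W' : Π x : X, CT E x} (hW : CDiffAt W x) (hW' : CDiffAt W' x) :
    bracket Z (fun y => W y + W' y) x = bracket Z W x + bracket Z W' x := by
  refine ext_re_im ?_ ?_
  · simp only [re_bracket, map_add]
    rw [mlieBracket_add_right' hW.1 hW'.1, mlieBracket_add_right' hW.2 hW'.2]
    abel
  · simp only [im_bracket, map_add]
    rw [mlieBracket_add_right' hW.1 hW'.1, mlieBracket_add_right' hW.2 hW'.2]
    abel

lemma bracket_add_left {Z Z' W : Π x : X, CT E x} (hZ : CDiffAt Z x) (hZ' : CDiffAt Z' x) :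
    bracket (fun y => Z y + Z' y) W x = bracket Z W x + bracket Z' W x := by
  rw [bracket_swap, bracket_add_right hZ hZ', bracket_swap Z, bracket_swap Z']
  abel

lemma conj_bracket {Z W : Π x : X, CT E x} (hZ : CDiffAt Z x) (hW : CDiffAt W x) :
    conj x (bracket Z W x) = bracket (fun y => conj y (Z y)) (fun y => conj y (W y)) x := by
  refine ext_re_im ?_ ?_
  · simp only [re_bracket, re_conj, im_conj]
    rw [mlieBracket_neg_right hW.2, mlieBracket_neg_left hZ.2, neg_neg]
  · simp only [im_bracket, re_conj, im_conj]
    rw [mlieBracket_neg_right hW.2, mlieBracket_neg_left hZ.2]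
    abel

/-- On a complex manifold the bracket of vector fields of type `(1,0)` is of type `(1,0)`. -/
lemma bracket_mem_T10 {V W : Π x : X, T10 E x} (hV : DiffAt V x) (hW : DiffAt W x) :
    bracket (toCT V) (toCT W) x ∈ T10 E x := by
  have h := mlieBracket_J_J hV.1 hW.1
  have hJV : MDifferentiableAt 𝓘(ℝ, E) 𝓘(ℝ, E).tangent
      (fun y => (⟨y, J E y (re y (V y))⟩ : TangentBundle 𝓘(ℝ, E) X)) x := by
    simpa [im_eq_of_T10] using! mdifferentiableAt_neg_section hV.2
  have hJW : MDifferentiableAt 𝓘(ℝ, E) 𝓘(ℝ, E).tangent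
      (fun y => (⟨y, J E y (re y (W y))⟩ : TangentBundle 𝓘(ℝ, E) X)) x := by
    simpa [im_eq_of_T10] using! mdifferentiableAt_neg_section hW.2
  -- With imaginary parts equal to -J of real parts, the condition to be of type (1,0) is the
  -- Nijenhuis identity `h` up to applying J.
  rw [mem_T10_iff, im_bracket, re_bracket]
  simp only [toCT, im_eq_of_T10]
  rw [mlieBracket_neg_right hJW, mlieBracket_neg_left hJV, mlieBracket_neg_left hJV,
    mlieBracket_neg_right hJW, neg_neg, h]
  simp only [map_sub, map_add, J_J]
  abel

lemma coe_proj10_bracket {V W : Π x : X, T10 E x} (hV : DiffAt V x) (hW : DiffAt W x) :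
    (proj10 x (bracket (toCT V) (toCT W) x) : CT E x) = bracket (toCT V) (toCT W) x :=
  proj10_of_mem (bracket_mem_T10 hV hW)

lemma bracket_bar_bar {V W : Π x : X, T10 E x} (hV : DiffAt V x) (hW : DiffAt W x) :
    bracket (bar V) (bar W) x = bar (fun y => proj10 y (bracket (toCT V) (toCT W) y)) x := by
  rw [bar, coe_proj10_bracket hV hW, conj_bracket hV.toCT hW.toCT]
  rfl

lemma contMDiffOn_mlieBracket {V W : Π x : X, RT E x} {U : Set X} (hU : IsOpen U)
    (hV : ContMDiffOn 𝓘(ℝ, E) 𝓘(ℝ, E).tangent ∞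
      (fun y => (⟨y, V y⟩ : TangentBundle 𝓘(ℝ, E) X)) U)
    (hW : ContMDiffOn 𝓘(ℝ, E) 𝓘(ℝ, E).tangent ∞
      (fun y => (⟨y, W y⟩ : TangentBundle 𝓘(ℝ, E) X)) U) :
    ContMDiffOn 𝓘(ℝ, E) 𝓘(ℝ, E).tangent ∞ (fun y =>
      (⟨y, VectorField.mlieBracket 𝓘(ℝ, E) V W y⟩ : TangentBundle 𝓘(ℝ, E) X)) U := by
  intro y hy
  have : IsManifold 𝓘(ℝ, E) (((⊤ : ℕ∞) : ℕ∞ω) + 1) X := isManifold_real (E := E) (X := X)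
  have : IsManifold 𝓘(ℝ, E) (minSmoothness ℝ 2) X := by
    rw [minSmoothness_of_isRCLikeNormedField]; infer_instance
  exact (ContMDiffAt.mlieBracket_vectorField (n := ⊤) (m := ⊤)
    (hV.contMDiffAt (hU.mem_nhds hy)) (hW.contMDiffAt (hU.mem_nhds hy))
    (by simp)).contMDiffWithinAt

lemma SmoothOn.bracket {Z W : Π x : X, CT E x} {U : Set X} (hU : IsOpen U) (hZ : SmoothOn Z U)
    (hW : SmoothOn W U) : SmoothOn (bracket Z W) U := by
  simp only [SmoothOn, re_bracket, im_bracket]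
  exact ⟨(contMDiffOn_mlieBracket hU hZ.1 hW.1).sub_section (contMDiffOn_mlieBracket hU hZ.2 hW.2),
    (contMDiffOn_mlieBracket hU hZ.1 hW.2).add_section (contMDiffOn_mlieBracket hU hZ.2 hW.1)⟩

lemma mlieBracket_sub_left {V V' W : Π x : X, RT E x}
    (hV : MDifferentiableAt 𝓘(ℝ, E) 𝓘(ℝ, E).tangent
      (fun y => (⟨y, V y⟩ : TangentBundle 𝓘(ℝ, E) X)) x)
    (hV' : MDifferentiableAt 𝓘(ℝ, E) 𝓘(ℝ, E).tangent
      (fun y => (⟨y, V' y⟩ : TangentBundle 𝓘(ℝ, E) X)) x) :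
    VectorField.mlieBracket 𝓘(ℝ, E) (fun y => V y - V' y) W x =
      VectorField.mlieBracket 𝓘(ℝ, E) V W x - VectorField.mlieBracket 𝓘(ℝ, E) V' W x := by
  rw [VectorField.mlieBracket_swap_apply, mlieBracket_sub_right hV hV',
    VectorField.mlieBracket_swap_apply (V := V), VectorField.mlieBracket_swap_apply (V := V')]
  abel

lemma mlieBracket_add_left' {V V' W : Π x : X, RT E x}
    (hV : MDifferentiableAt 𝓘(ℝ, E) 𝓘(ℝ, E).tangent
      (fun y => (⟨y, V y⟩ : TangentBundle 𝓘(ℝ, E) X)) x)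
    (hV' : MDifferentiableAt 𝓘(ℝ, E) 𝓘(ℝ, E).tangent
      (fun y => (⟨y, V' y⟩ : TangentBundle 𝓘(ℝ, E) X)) x) :
    VectorField.mlieBracket 𝓘(ℝ, E) (fun y => V y + V' y) W x =
      VectorField.mlieBracket 𝓘(ℝ, E) V W x + VectorField.mlieBracket 𝓘(ℝ, E) V' W x :=
  VectorField.mlieBracket_add_left hV hV'

/-- The Jacobi identity for complex vector fields. -/
lemma bracket_bracket {Z V W : Π x : X, CT E x} {U : Set X} (hU : IsOpen U) (hZ : SmoothOn Z U)
    (hV : SmoothOn V U) (hW : SmoothOn W U) (hx : x ∈ U) :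
    bracket Z (bracket V W) x = bracket (bracket Z V) W x + bracket V (bracket Z W) x := by
  have : IsManifold 𝓘(ℝ, E) (minSmoothness ℝ 3) X := by
    rw [minSmoothness_of_isRCLikeNormedField]; infer_instance
  have jacobi {A B C : Π x : X, RT E x} (hA : ContMDiffOn 𝓘(ℝ, E) 𝓘(ℝ, E).tangent ∞
        (fun y => (⟨y, A y⟩ : TangentBundle 𝓘(ℝ, E) X)) U)
      (hB : ContMDiffOn 𝓘(ℝ, E) 𝓘(ℝ, E).tangent ∞
        (fun y => (⟨y, B y⟩ : TangentBundle 𝓘(ℝ, E) X)) U)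
      (hC : ContMDiffOn 𝓘(ℝ, E) 𝓘(ℝ, E).tangent ∞
        (fun y => (⟨y, C y⟩ : TangentBundle 𝓘(ℝ, E) X)) U) :=
    VectorField.leibniz_identity_mlieBracket_apply (U := A) (V := B) (W := C) (x := x)
      ((hA.contMDiffAt (hU.mem_nhds hx)).of_le (by simpa using ENat.LEInfty.out))
      ((hB.contMDiffAt (hU.mem_nhds hx)).of_le (by simpa using ENat.LEInfty.out))
      ((hC.contMDiffAt (hU.mem_nhds hx)).of_le (by simpa using ENat.LEInfty.out))
  have md {A B : Π x : X, RT E x} (hA : ContMDiffOn 𝓘(ℝ, E) 𝓘(ℝ, E).tangent ∞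
        (fun y => (⟨y, A y⟩ : TangentBundle 𝓘(ℝ, E) X)) U)
      (hB : ContMDiffOn 𝓘(ℝ, E) 𝓘(ℝ, E).tangent ∞
        (fun y => (⟨y, B y⟩ : TangentBundle 𝓘(ℝ, E) X)) U) :
      MDifferentiableAt 𝓘(ℝ, E) 𝓘(ℝ, E).tangent
        (fun y => (⟨y, VectorField.mlieBracket 𝓘(ℝ, E) A B y⟩ : TangentBundle 𝓘(ℝ, E) X)) x :=
    ((contMDiffOn_mlieBracket hU hA hB).contMDiffAt (hU.mem_nhds hx)).mdifferentiableAt (by simp)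
  obtain ⟨a, b⟩ := hZ
  obtain ⟨c, d⟩ := hV
  obtain ⟨e, f⟩ := hW
  refine ext_re_im ?_ ?_
  · rw [map_add]
    simp only [re_bracket, im_bracket]
    rw [mlieBracket_sub_right (md c e) (md d f), mlieBracket_add_right' (md c f) (md d e),
      mlieBracket_sub_left (md a c) (md b d), mlieBracket_add_left' (md a d) (md b c),
      mlieBracket_sub_right (md a e) (md b f), mlieBracket_add_right' (md a f) (md b e),
      jacobi a c e, jacobi a d f, jacobi b c f, jacobi b d e]
    abel
  · rw [map_add]
    simp only [re_bracket, im_bracket]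
    rw [mlieBracket_sub_right (md c e) (md d f), mlieBracket_add_right' (md c f) (md d e),
      mlieBracket_sub_left (md a c) (md b d), mlieBracket_add_left' (md a d) (md b c),
      mlieBracket_sub_right (md a e) (md b f), mlieBracket_add_right' (md a f) (md b e),
      jacobi a c f, jacobi a d e, jacobi b c e, jacobi b d f]
    abel

end BracketAlgebra

/-! ### Bilinear extension of the metric -/

section MetricAlgebra

variable {E : Type*} [NormedAddCommGroup E] [NormedSpace ℂ E]
  {X : Type*} [TopologicalSpace X] [ChartedSpace E X] {x : X}

lemma dC_apply (f : X → ℂ) (Z : CT E x) :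
    dC f x Z = mvfderiv 𝓘(ℝ, E) f x (re x Z) + Complex.I * mvfderiv 𝓘(ℝ, E) f x (im x Z) := by
  conv_lhs => rw [← ofReal_re_add_im Z]
  simp [dC, ofReal]

lemma dC_congr {f f' : X → ℂ} (h : f =ᶠ[𝓝 x] f') (Z : CT E x) : dC f x Z = dC f' x Z := by
  have h1 (v : RT E x) : mvfderiv 𝓘(ℝ, E) f x v = mvfderiv 𝓘(ℝ, E) f' x v :=
    congrArg (fun A : E →L[ℝ] ℂ => A v) (h.mfderiv_eq (I := 𝓘(ℝ, E)) (I' := 𝓘(ℝ, ℂ)))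
  rw [dC_apply, dC_apply, h1, h1]

lemma dC_const (c : ℂ) : dC (E := E) (fun _ : X => c) x = 0 := by
  rw [dC, mvfderiv_const]; ext; simp

lemma mdifferentiableAt_ofReal_add {f g : X → ℝ} (hf : MDifferentiableAt 𝓘(ℝ, E) 𝓘(ℝ, ℝ) f x)
    (hg : MDifferentiableAt 𝓘(ℝ, E) 𝓘(ℝ, ℝ) g x) :
    MDifferentiableAt 𝓘(ℝ, E) 𝓘(ℝ, ℂ) (fun y => (f y : ℂ) + Complex.I * (g y : ℂ)) x ∧
    ∀ v, mvfderiv 𝓘(ℝ, E) (fun y => (f y : ℂ) + Complex.I * (g y : ℂ)) x v =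
      (mvfderiv 𝓘(ℝ, E) f x v : ℂ) + Complex.I * (mvfderiv 𝓘(ℝ, E) g x v : ℂ) := by
  have h1 : HasMFDerivAt 𝓘(ℝ, E) 𝓘(ℝ, ℂ) (fun y => (f y : ℂ)) x _ :=
    (Complex.ofRealCLM.hasMFDerivAt (x := f x)).comp x hf.hasMFDerivAt
  have h2 : HasMFDerivAt 𝓘(ℝ, E) 𝓘(ℝ, ℂ) (fun y => Complex.I * (g y : ℂ)) x _ :=
    ((Complex.I • Complex.ofRealCLM).hasMFDerivAt (x := g x)).comp x hg.hasMFDerivAt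
  have h3 := h1.add h2
  refine ⟨h3.mdifferentiableAt, fun v => ?_⟩
  have h4 := h3.mfderiv
  exact congrArg (fun A : E →L[ℝ] ℂ => A v) h4

variable [Bundle.RiemannianBundle (fun x : X => TangentSpace 𝓘(ℝ, E) x)]

lemma gC_apply (Z W : CT E x) :
    gC x Z W = ((inner ℝ (re x Z) (re x W) - inner ℝ (im x Z) (im x W) : ℝ) : ℂ) +
      Complex.I * ((inner ℝ (re x Z) (im x W) + inner ℝ (im x Z) (re x W) : ℝ) : ℂ) := by
  have h (u v : RT E x) : gC x (ofReal x u) (ofReal x v) = ((inner ℝ u v : ℝ) : ℂ) := by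
    simp [gC, ofReal]
  conv_lhs => rw [← ofReal_re_add_im Z, ← ofReal_re_add_im W]
  simp only [map_add, map_smul, LinearMap.add_apply, LinearMap.smul_apply, h, smul_eq_mul]
  push_cast
  linear_combination ((inner ℝ (im x Z) (im x W) : ℝ) : ℂ) * Complex.I_mul_I

lemma gC_comm (Z W : CT E x) : gC x Z W = gC x W Z := by
  rw [gC_apply, gC_apply, real_inner_comm, real_inner_comm (im x Z),
    real_inner_comm (im x Z) (re x W), real_inner_comm (re x Z) (im x W)]
  push_cast; ring

lemma gC_conj_conj (Z W : CT E x) :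
    gC x (conj x Z) (conj x W) = starRingEnd ℂ (gC x Z W) := by
  rw [gC_apply, gC_apply]
  apply Complex.ext
  · simp
  · simp; ring

/-- J-invariance gives g(V,W) = g(JV,JW) = (√-1)² g(V,W), so T^{1,0} is isotropic. -/
lemma gC_coe_coe (hg : IsHermitianMetric E X) (V W : T10 E x) : gC x (V : CT E x) W = 0 := by
  rw [gC_apply, im_eq_of_T10, im_eq_of_T10]
  have h := hg x (re x (V : CT E x)) (J E x (re x W))
  rw [J_J] at h
  rw [inner_neg_right] at h
  simp only [inner_neg_left, inner_neg_right, hg x]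
  rw [← h]; simp

/-- T^{0,1} is isotropic too, so projections to T^{1,0} can be dropped in any pairing with a (0,1)
vector. -/
lemma gC_proj10_conj (hg : IsHermitianMetric E X) (Z : CT E x) (W : T10 E x) :
    gC x (proj10 x Z : CT E x) (conj x (W : CT E x)) = gC x Z (conj x (W : CT E x)) := by
  nth_rw 2 [← conj_proj10_conj_mem_add Z]
  rw [map_add, LinearMap.add_apply, gC_conj_conj, gC_coe_coe hg, map_zero, add_zero]

lemma gC_conj_eq_proj10 (hg : IsHermitianMetric E X) (Z : CT E x) (V : T10 E x) :
    gC x (V : CT E x) Z = gC x (V : CT E x) (conj x (proj10 x (conj x Z) : CT E x)) := by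
  nth_rw 1 [← conj_proj10_conj_mem_add Z]
  rw [map_add, gC_coe_coe hg, zero_add]

end MetricAlgebra

/-! ### Complex-linear extension of the Levi-Civita connection -/

section LeviCivita

variable {E : Type*} [NormedAddCommGroup E] [NormedSpace ℂ E]
  {X : Type*} [TopologicalSpace X] [ChartedSpace E X] {x : X} [IsManifold 𝓘(ℂ, E) ω X]

/-- The complex-linear extension of a connection on the real tangent bundle. -/
def complexify (L : CovariantDerivative 𝓘(ℝ, E) E (fun x : X => TangentSpace 𝓘(ℝ, E) x))
    (W : Π x : X, CT E x) (x : X) : CT E x →ₗ[ℂ] CT E x :=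
  LinearMap.liftBaseChange ℂ
    (ofReal x ∘ₗ (L (fun y => re y (W y : CT E y)) x).toLinearMap +
      Complex.I • (ofReal x ∘ₗ (L (fun y => im y (W y : CT E y)) x).toLinearMap))

lemma lichnerowicz_apply
    (L : CovariantDerivative 𝓘(ℝ, E) E (fun x : X => TangentSpace 𝓘(ℝ, E) x))
    (W : Π x : X, T10 E x) (Z : CT E x) :
    lichnerowicz L W x Z = proj10 x (complexify L (toCT W) x Z) := rfl

lemma complexify_apply (L : CovariantDerivative 𝓘(ℝ, E) E (fun x : X => TangentSpace 𝓘(ℝ, E) x))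
    (W : Π x : X, CT E x) (Z : CT E x) :
    complexify L W x Z = ofReal x (L (fun y => re y (W y)) x (re x Z)) +
      Complex.I • ofReal x (L (fun y => im y (W y)) x (re x Z)) +
      Complex.I • ofReal x (L (fun y => re y (W y)) x (im x Z)) -
      ofReal x (L (fun y => im y (W y)) x (im x Z)) := by
  conv_lhs => rw [← ofReal_re_add_im Z]
  have h (v : RT E x) : complexify L W x (ofReal x v) = ofReal x (L (fun y => re y (W y)) x v) +
      Complex.I • ofReal x (L (fun y => im y (W y)) x v) := by
    simp only [complexify, ofReal, TensorProduct.mk_apply, LinearMap.liftBaseChange_tmul, one_smul]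
    rfl
  rw [map_add, map_smul, h, h, smul_add, smul_smul, Complex.I_mul_I]
  module

lemma re_complexify (L : CovariantDerivative 𝓘(ℝ, E) E (fun x : X => TangentSpace 𝓘(ℝ, E) x))
    (W : Π x : X, CT E x) (Z : CT E x) :
    re x (complexify L W x Z) =
      L (fun y => re y (W y)) x (re x Z) - L (fun y => im y (W y)) x (im x Z) := by
  simp [complexify_apply, re_smul]

lemma im_complexify (L : CovariantDerivative 𝓘(ℝ, E) E (fun x : X => TangentSpace 𝓘(ℝ, E) x))
    (W : Π x : X, CT E x) (Z : CT E x) :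
    im x (complexify L W x Z) =
      L (fun y => im y (W y)) x (re x Z) + L (fun y => re y (W y)) x (im x Z) := by
  simp [complexify_apply, im_smul]

variable [Bundle.RiemannianBundle (fun x : X => TangentSpace 𝓘(ℝ, E) x)]

lemma IsLeviCivita.complexify_sub [FiniteDimensional ℂ E]
    {L : CovariantDerivative 𝓘(ℝ, E) E (fun x : X => TangentSpace 𝓘(ℝ, E) x)}
    (hL : IsLeviCivita L) {Z W : Π x : X, CT E x} (hZ : CDiffAt Z x) (hW : CDiffAt W x) :
    complexify L W x (Z x) - complexify L Z x (W x) = bracket Z W x := by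
  have : CompleteSpace E := FiniteDimensional.complete ℂ E
  have h {V W : Π x : X, RT E x} :=
    L.torsion_eq_zero_iff.1 hL.torsionFree (X := V) (Y := W) (x := x)
  refine ext_re_im ?_ ?_
  · rw [map_sub, re_complexify, re_complexify, re_bracket, ← h hZ.1 hW.1, ← h hZ.2 hW.2]
    abel
  · rw [map_sub, im_complexify, im_complexify, im_bracket, ← h hZ.1 hW.2, ← h hZ.2 hW.1]
    abel

variable [IsContMDiffRiemannianBundle 𝓘(ℝ, E) ∞ E (fun x : X => TangentSpace 𝓘(ℝ, E) x)]

lemma mdifferentiableAt_inner {V W : Π x : X, RT E x}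
    (hV : MDifferentiableAt 𝓘(ℝ, E) 𝓘(ℝ, E).tangent
      (fun y => (⟨y, V y⟩ : TangentBundle 𝓘(ℝ, E) X)) x)
    (hW : MDifferentiableAt 𝓘(ℝ, E) 𝓘(ℝ, E).tangent
      (fun y => (⟨y, W y⟩ : TangentBundle 𝓘(ℝ, E) X)) x) :
    MDifferentiableAt 𝓘(ℝ, E) 𝓘(ℝ, ℝ) (fun y => inner ℝ (V y) (W y)) x :=
  MDifferentiableAt.inner_bundle hV hW

lemma CDiffAt.gC {Z W : Π x : X, CT E x} (hZ : CDiffAt Z x) (hW : CDiffAt W x) :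
    MDifferentiableAt 𝓘(ℝ, E) 𝓘(ℝ, ℂ) (fun y => gC y (Z y) (W y)) x := by
  simp only [gC_apply]
  exact (mdifferentiableAt_ofReal_add
    ((mdifferentiableAt_inner hZ.1 hW.1).sub (mdifferentiableAt_inner hZ.2 hW.2))
    ((mdifferentiableAt_inner hZ.1 hW.2).add (mdifferentiableAt_inner hZ.2 hW.1))).1

variable [FiniteDimensional ℂ E]

lemma IsLeviCivita.dC_gC
    {L : CovariantDerivative 𝓘(ℝ, E) E (fun x : X => TangentSpace 𝓘(ℝ, E) x)}
    (hL : IsLeviCivita L) {Z W : Π x : X, CT E x} (hZ : CDiffAt Z x) (hW : CDiffAt W x)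
    (V : CT E x) :
    dC (fun y => HermitianGeometry.gC y (Z y) (W y)) x V =
      HermitianGeometry.gC x (complexify L Z x V) (W x) +
        HermitianGeometry.gC x (Z x) (complexify L W x V) := by
  have h11 := mdifferentiableAt_inner hZ.1 hW.1
  have h22 := mdifferentiableAt_inner hZ.2 hW.2
  have h12 := mdifferentiableAt_inner hZ.1 hW.2
  have h21 := mdifferentiableAt_inner hZ.2 hW.1
  have h := (mdifferentiableAt_ofReal_add (h11.sub h22) (h12.add h21)).2
  have hf := funext fun y => gC_apply (x := y) (Z y) (W y)
  have h' (v : RT E x) := (congrArg (fun f => mvfderiv 𝓘(ℝ, E) f x v) hf).trans (h v)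
  have hs (v : RT E x) : mvfderiv 𝓘(ℝ, E) ((fun y => inner ℝ (re y (Z y)) (re y (W y))) -
      fun y => inner ℝ (im y (Z y)) (im y (W y))) x v = _ :=
    (congrArg (fun A : RT E x →L[ℝ] ℝ => A v) (mvfderiv_sub h11 h22)).trans
      (congrArg₂ (· - ·) (hL.metric _ _ x hZ.1 hW.1 v) (hL.metric _ _ x hZ.2 hW.2 v))
  have ha (v : RT E x) : mvfderiv 𝓘(ℝ, E) ((fun y => inner ℝ (re y (Z y)) (im y (W y))) +
      fun y => inner ℝ (im y (Z y)) (re y (W y))) x v = _ :=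
    (congrArg (fun A : RT E x →L[ℝ] ℝ => A v) (mvfderiv_add h12 h21)).trans
      (congrArg₂ (· + ·) (hL.metric _ _ x hZ.1 hW.2 v) (hL.metric _ _ x hZ.2 hW.1 v))
  rw [dC_apply, h', h', hs, hs, ha, ha, gC_apply, gC_apply]
  simp only [re_complexify, im_complexify, inner_add_left, inner_add_right, inner_sub_left,
    inner_sub_right]
  push_cast
  ring_nf
  rw [Complex.I_sq]
  ring

end LeviCivita

/-! ### The difference of the Chern and Lichnerowicz connections in terms of torsion -/

section Koszul

variable {E : Type*} [NormedAddCommGroup E] [NormedSpace ℂ E]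
  {X : Type*} [TopologicalSpace X] [ChartedSpace E X] {x : X}

lemma torsion_swap (C : T10Operator E X) (V W : Π x : X, T10 E x) (x : X) :
    torsion C V W x = -torsion C W V x := by
  rw [torsion, torsion, bracket_swap, map_neg]
  abel

lemma gC_proj10_bar [Bundle.RiemannianBundle (fun x : X => TangentSpace 𝓘(ℝ, E) x)]
    (hg : IsHermitianMetric E X) (Z : CT E x) (w : Π x : X, T10 E x) :
    gC x (proj10 x Z : CT E x) (bar w x) = gC x Z (bar w x) :=
  gC_proj10_conj hg Z (w x)

variable [IsManifold 𝓘(ℂ, E) ω X]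

/-- Twice the difference of the Chern and the Lichnerowicz connections. -/
def chernDefect (C : T10Operator E X)
    (L : CovariantDerivative 𝓘(ℝ, E) E (fun x : X => TangentSpace 𝓘(ℝ, E) x)) :
    T10Operator E X := fun W x => (2 : ℂ) • (C W x - lichnerowicz L W x)

/-- The factor 2 in `chernDefect` is what makes its components equal to torsion components, and is
compensated here by the coefficient (1-t)/2. -/
lemma gauduchon_eq (C : T10Operator E X)
    (L : CovariantDerivative 𝓘(ℝ, E) E (fun x : X => TangentSpace 𝓘(ℝ, E) x)) (t : ℝ)
    (W : Π x : X, T10 E x) (Z : CT E x) :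
    gauduchon C L t W x Z = C W x Z - ((1 - (t : ℂ)) / 2) • chernDefect C L W x Z := by
  simp only [gauduchon, chernDefect, LinearMap.add_apply, LinearMap.sub_apply,
    LinearMap.smul_apply]
  module

variable [Bundle.RiemannianBundle (fun x : X => TangentSpace 𝓘(ℝ, E) x)]

lemma IsChernConnection.gC_apply_bar (hg : IsHermitianMetric E X) {C : T10Operator E X}
    (hC : IsChernConnection C) {u v : Π x : X, T10 E x} (hu : DiffAt u x) (hv : DiffAt v x)
    (w : Π x : X, T10 E x) :
    gC x (C v x (bar u x) : CT E x) (bar w x) =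
      gC x (bracket (bar u) (toCT v) x) (bar w x) := by
  refine Eq.trans ?_ (gC_proj10_conj hg (bracket (bar u) (toCT v) x) (w x))
  exact congrArg (fun z : T10 E x => gC x (z : CT E x) (bar w x))
    (hC.complexAnalytic u v x hu hv)

lemma PreservesMetric.dC_herm {D : T10Operator E X} (hD : PreservesMetric D)
    {v w : Π x : X, T10 E x} (hv : DiffAt v x) (hw : DiffAt w x) (Z : CT E x) :
    dC (herm v w) x Z = gC x (D v x Z : CT E x) (bar w x) +
      gC x (toCT v x) (conj x (D w x (conj x Z) : CT E x)) :=
  hD v w x hv hw Z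

lemma IsLeviCivita.dC_herm [FiniteDimensional ℂ E]
    [IsContMDiffRiemannianBundle 𝓘(ℝ, E) ∞ E (fun x : X => TangentSpace 𝓘(ℝ, E) x)]
    {L : CovariantDerivative 𝓘(ℝ, E) E (fun x : X => TangentSpace 𝓘(ℝ, E) x)}
    (hL : IsLeviCivita L) {v w : Π x : X, T10 E x} (hv : DiffAt v x) (hw : DiffAt w x)
    (Z : CT E x) :
    dC (herm v w) x Z = gC x (complexify L (toCT v) x Z) (bar w x) +
      gC x (toCT v x) (complexify L (bar w) x Z) :=
  hL.dC_gC hv.toCT hw.bar Z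

variable [FiniteDimensional ℂ E]

/-- In the metric identity the second term involves ∇_ū w, which is a ∂̄-derivative and hence a
bracket; only ∇_u v remains as a connection term. -/
lemma IsChernConnection.dC_herm_toCT (hg : IsHermitianMetric E X) {C : T10Operator E X}
    (hC : IsChernConnection C) {u v w : Π x : X, T10 E x} (hu : DiffAt u x) (hv : DiffAt v x)
    (hw : DiffAt w x) :
    dC (herm v w) x (toCT u x) = gC x (C v x (toCT u x) : CT E x) (bar w x) +
      gC x (toCT v x) (bracket (toCT u) (bar w) x) := by
  have : CompleteSpace E := FiniteDimensional.complete ℂ E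
  have h1 := hC.hermitian v w x hv hw (toCT u x)
  have h2 : C w x (conj x (toCT u x)) = proj10 x (bracket (bar u) (toCT w) x) :=
    hC.complexAnalytic u w x hu hw
  have h3 : conj x (bracket (toCT u) (bar w) x) = bracket (bar u) (toCT w) x := by
    rw [conj_bracket hu.toCT hw.bar]
    simp only [bar, conj_conj]
    rfl
  rw [h1, h2, ← h3]
  exact congrArg _ (gC_conj_eq_proj10 hg _ _).symm

variable [IsContMDiffRiemannianBundle 𝓘(ℝ, E) ∞ E (fun x : X => TangentSpace 𝓘(ℝ, E) x)]

/-- Comparing the derivatives of h(v,w) along u, and removing the bracket by vanishing torsion,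
gives g((C-L)_u v, w̄) = g(v, L_w̄ u). Adding the same with u and v exchanged yields the derivative
of g(u,v) = 0 along w̄. Hence (C-L)_u v is antisymmetric in u, v, and its double is the difference
of the two torsions, of which that of L vanishes. -/
lemma gC_chernDefect_toCT (hg : IsHermitianMetric E X) {C : T10Operator E X}
    (hC : IsChernConnection C)
    {L : CovariantDerivative 𝓘(ℝ, E) E (fun x : X => TangentSpace 𝓘(ℝ, E) x)}
    (hL : IsLeviCivita L) {u v w : Π x : X, T10 E x} (hu : DiffAt u x) (hv : DiffAt v x)
    (hw : DiffAt w x) :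
    gC x (chernDefect C L v x (toCT u x) : CT E x) (bar w x) =
      gC x (torsion C u v x : CT E x) (bar w x) := by
  have e1 := hC.dC_herm_toCT hg hu hv hw
  have e2 := hC.dC_herm_toCT hg hv hu hw
  have f1 := hL.dC_herm hv hw (toCT u x)
  have f2 := hL.dC_herm hu hw (toCT v x)
  have f3 := hL.dC_gC hu.toCT hv.toCT (bar w x)
  have hz : (fun y => gC y (toCT u y) (toCT v y)) = fun _ => (0 : ℂ) :=
    funext fun y => gC_coe_coe hg (u y) (v y)
  rw [hz, dC_const, LinearMap.zero_apply] at f3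
  have t1 := congrArg (fun Z => gC x Z (bar w x)) (hL.complexify_sub hu.toCT hv.toCT)
  have t2 := congrArg (fun Z => gC x (toCT v x) Z) (hL.complexify_sub hu.toCT hw.bar)
  have t3 := congrArg (fun Z => gC x (toCT u x) Z) (hL.complexify_sub hv.toCT hw.bar)
  simp only [map_sub, LinearMap.sub_apply] at t1 t2 t3
  have c1 := gC_comm (complexify L (toCT u) x (bar w x)) (toCT v x)
  have h1 := gC_proj10_bar hg (complexify L (toCT v) x (toCT u x)) w
  have h2 := gC_proj10_bar hg (bracket (toCT u) (toCT v) x) w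
  simp only [chernDefect, torsion, cov, LinearMap.smul_apply, LinearMap.sub_apply,
    lichnerowicz_apply, Submodule.coe_smul, Submodule.coe_sub, map_smul, map_sub, smul_eq_mul]
  rw [h1, h2]
  linear_combination f1 - e1 + f2 - e2 + t2 + t3 - t1 - f3 - c1

/-- Since C_ū v is the (1,0)-part of [ū,v], vanishing torsion gives g((C-L)_ū v, w̄) = -g(L_v ū,
w̄), which is antisymmetric in u, w because g(ū,w̄) = 0. Metric compatibility also writes it as g(v,
L_ū w̄ - conj(C_u w)); antisymmetrizing this expression produces the conjugate torsion. -/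
lemma gC_chernDefect_bar (hg : IsHermitianMetric E X) {C : T10Operator E X}
    (hC : IsChernConnection C)
    {L : CovariantDerivative 𝓘(ℝ, E) E (fun x : X => TangentSpace 𝓘(ℝ, E) x)}
    (hL : IsLeviCivita L) {u v w : Π x : X, T10 E x} (hu : DiffAt u x) (hv : DiffAt v x)
    (hw : DiffAt w x) :
    gC x (chernDefect C L v x (bar u x) : CT E x) (bar w x) =
      -gC x (toCT v x) (bar (torsion C u w) x) := by
  have : CompleteSpace E := FiniteDimensional.complete ℂ E
  have p1 := hC.hermitian.dC_herm hv hw (bar u x)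
  have p2 := hC.hermitian.dC_herm hv hu (bar w x)
  have a1 := hC.gC_apply_bar hg hu hv w
  have a2 := hC.gC_apply_bar hg hw hv u
  have m1 := hL.dC_herm hv hw (bar u x)
  have m2 := hL.dC_herm hv hu (bar w x)
  have m3 := hL.dC_gC hu.bar hw.bar (toCT v x)
  have hz : (fun y => gC y (bar u y) (bar w y)) = fun _ => (0 : ℂ) :=
    funext fun y => (gC_conj_conj _ _).trans (by rw [gC_coe_coe hg, map_zero])
  rw [hz, dC_const, LinearMap.zero_apply] at m3
  have t1 := congrArg (fun Z => gC x Z (bar w x)) (hL.complexify_sub hu.bar hv.toCT)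
  have t2 := congrArg (fun Z => gC x Z (bar u x)) (hL.complexify_sub hw.bar hv.toCT)
  have t3 := congrArg (fun Z => gC x (toCT v x) Z) (hL.complexify_sub hu.bar hw.bar)
  simp only [map_sub, LinearMap.sub_apply] at t1 t2 t3
  have c1 := gC_comm (complexify L (bar w) x (toCT v x)) (bar u x)
  have h1 := gC_proj10_bar hg (complexify L (toCT v) x (bar u x)) w
  have h2 : conj x (proj10 x (bracket (toCT u) (toCT w) x) : CT E x) = bracket (bar u) (bar w) x :=
    (bracket_bar_bar hu hw).symm
  have h3 : bar (torsion C u w) x = conj x (C w x (toCT u x) : CT E x) -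
      conj x (C u x (toCT w x) : CT E x) - bracket (bar u) (bar w) x := by
    rw [← h2, bar, torsion, cov, cov, Submodule.coe_sub, Submodule.coe_sub, map_sub, map_sub]
  rw [h3]
  have hu' : conj x (bar u x) = toCT u x := conj_conj _
  have hw' : conj x (bar w x) = toCT w x := conj_conj _
  rw [hu'] at p1
  rw [hw'] at p2
  simp only [chernDefect, LinearMap.smul_apply, LinearMap.sub_apply,
    lichnerowicz_apply, Submodule.coe_smul, Submodule.coe_sub, map_smul, map_sub, smul_eq_mul]
  rw [h1]
  linear_combination m1 - p1 - m2 + p2 + t3 + a1 + a2 - t1 - t2 + m3 - c1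

end Koszul

/-! ### Connections as local operators -/

section Connections

variable {E : Type*} [NormedAddCommGroup E] [NormedSpace ℂ E]
  {X : Type*} [TopologicalSpace X] [ChartedSpace E X] {x : X} [IsManifold 𝓘(ℂ, E) ω X]

lemma DiffAt.congr {V W : Π x : X, T10 E x} (h : DiffAt V x) (hVW : ∀ᶠ y in 𝓝 x, V y = W y) :
    DiffAt W x :=
  CDiffAt.congr h.toCT (hVW.mono fun y hy => congrArg (fun z : T10 E y => (z : CT E y)) hy)

lemma DiffAt.smul {f : X → ℂ} {V : Π x : X, T10 E x}
    (hf : MDifferentiableAt 𝓘(ℝ, E) 𝓘(ℝ, ℂ) f x) (h : DiffAt V x) :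
    DiffAt (fun y => f y • V y) x :=
  CDiffAt.smul hf h.toCT

lemma DiffAt.add {V W : Π x : X, T10 E x} (hV : DiffAt V x) (hW : DiffAt W x) :
    DiffAt (fun y => V y + W y) x :=
  CDiffAt.add hV.toCT hW.toCT

lemma DiffAt.sub_smul {V W : Π x : X, T10 E x} (hV : DiffAt V x) (c : ℂ) (hW : DiffAt W x) :
    DiffAt (fun y => V y - c • W y) x :=
  (hV.add (hW.smul (f := fun _ => -c) mdifferentiableAt_const)).congr
    (Filter.Eventually.of_forall fun y => by module)

lemma DiffAt.sum {ι : Type*} (s : Finset ι) {V : ι → Π x : X, T10 E x} (hs : s.Nonempty)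
    (hV : ∀ i, DiffAt (V i) x) : DiffAt (fun y => ∑ i ∈ s, V i y) x := by
  induction hs using Finset.Nonempty.cons_induction with
  | singleton a => simpa using hV a
  | cons a s ha hs ih =>
    simp only [Finset.sum_cons]
    exact (hV a).add ih

/-- A connection is a local operator. -/
lemma IsConnection.congr {D : T10Operator E X} (hD : IsConnection D) {V W : Π x : X, T10 E x}
    (hV : DiffAt V x) (hVW : ∀ᶠ y in 𝓝 x, V y = W y) : D V x = D W x := by
  classical
  have hW := hV.congr hVW
  -- No bump function is needed: f V = f W holds everywhere, while f = 1 near x, so the Leibniz rule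
  -- at x compares the two derivatives.
  let f : X → ℂ := fun y => if V y = W y then 1 else 0
  have hf1 : f =ᶠ[𝓝 x] fun _ => (1 : ℂ) := hVW.mono fun y hy => if_pos hy
  have hf : MDifferentiableAt 𝓘(ℝ, E) 𝓘(ℝ, ℂ) f x :=
    mdifferentiableAt_const.congr_of_eventuallyEq hf1
  have hfVW : (fun y => f y • V y) = fun y => f y • W y := by
    funext y
    by_cases h : V y = W y
    · rw [h]
    · simp [f, h]
  refine LinearMap.ext fun Z => ?_
  have h1 := hD.leibniz hf hV Z
  have h2 := hD.leibniz hf hW Z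
  rw [dC_congr hf1, dC_const, hf1.self_of_nhds] at h1 h2
  rw [hfVW, h2] at h1
  simpa using h1.symm

lemma IsConnection.sub_smul {D : T10Operator E X} (hD : IsConnection D) {V W : Π x : X, T10 E x}
    (hV : DiffAt V x) (c : ℂ) (hW : DiffAt W x) (Z : CT E x) :
    D (fun y => V y - c • W y) x Z = D V x Z - c • D W x Z := by
  have h : (fun y => V y - c • W y) = fun y => V y + (-c) • W y := by
    funext y; module
  have h' := hD.leibniz (f := fun _ => -c) mdifferentiableAt_const hW Z
  rw [dC_const] at h'
  rw [h, hD.add hV (hW.smul mdifferentiableAt_const), LinearMap.add_apply, h']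
  simp only [LinearMap.zero_apply, zero_smul]
  module

lemma IsConnection.sub {D : T10Operator E X} (hD : IsConnection D) {V W : Π x : X, T10 E x}
    (hV : DiffAt V x) (hW : DiffAt W x) (Z : CT E x) :
    D (fun y => V y - W y) x Z = D V x Z - D W x Z := by
  simpa using hD.sub_smul hV 1 hW Z

/-! ### Curvature and first Bianchi identity of the Chern connection -/

section Chern

variable [FiniteDimensional ℂ E] {C : T10Operator E X} {U : Set X}

lemma smoothOn_proj10_bracket (hU : IsOpen U) {v w : Π x : X, T10 E x}
    (hv : SmoothOn (toCT v) U) (hw : SmoothOn (toCT w) U) :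
    SmoothOn (toCT fun y => proj10 y (bracket (toCT v) (toCT w) y)) U := by
  have : CompleteSpace E := FiniteDimensional.complete ℂ E
  exact (SmoothOn.bracket hU hv hw).congr fun y hy =>
    coe_proj10_bracket (hv.diffAt hU hy) (hw.diffAt hU hy)

lemma IsConnection.smoothOn_torsion (hC : IsConnection C) (hU : IsOpen U) {v w : Π x : X, T10 E x}
    (hv : SmoothOn (toCT v) U) (hw : SmoothOn (toCT w) U) :
    SmoothOn (toCT (torsion C v w)) U :=
  ((hC.smooth hU hv hw).sub (hC.smooth hU hw hv)).sub (smoothOn_proj10_bracket hU hv hw)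

variable [Bundle.RiemannianBundle (fun x : X => TangentSpace 𝓘(ℝ, E) x)]

/-- The type decomposition of the bracket of vector fields of types `(0,1)` and `(1,0)`. -/
lemma IsChernConnection.bracket_bar_toCT (hC : IsChernConnection C) {v w : Π x : X, T10 E x}
    (hv : DiffAt v x) (hw : DiffAt w x) :
    bracket (bar v) (toCT w) x = toCT (cov C (bar v) w) x - bar (cov C (bar w) v) x := by
  have : CompleteSpace E := FiniteDimensional.complete ℂ E
  have h : conj x (bracket (bar v) (toCT w) x) = -bracket (bar w) (toCT v) x := by
    rw [conj_bracket hv.bar hw.toCT, bracket_swap (bar w) (toCT v), neg_neg]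
    simp only [bar, conj_conj]
    rfl
  rw [toCT, bar, hC.complexAnalytic v w x hv hw, hC.complexAnalytic w v x hw hv]
  conv_lhs => rw [← conj_proj10_conj_mem_add (bracket (bar v) (toCT w) x), h]
  rw [map_neg, Submodule.coe_neg, map_neg, ← sub_eq_add_neg]
  rfl

/-- An equality of germs, so that it can be substituted inside a further bracket. -/
lemma IsChernConnection.toCT_cov_bar (hC : IsChernConnection C) {v w : Π x : X, T10 E x}
    (hU : IsOpen U) (hv : SmoothOn (toCT v) U) (hw : SmoothOn (toCT w) U) (hx : x ∈ U) :
    ∀ᶠ y in 𝓝 x, toCT (cov C (bar v) w) y =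
      bracket (bar v) (toCT w) y + bar (cov C (bar w) v) y := by
  filter_upwards [hU.mem_nhds hx] with y hy
  rw [hC.bracket_bar_toCT (hv.diffAt hU hy) (hw.diffAt hU hy), sub_add_cancel]

/-- Replacing ∇_v̄ w by [v̄,w] costs a field of type (0,1); its bracket with ū is again of type
(0,1) by integrability, so the projection kills it. -/
lemma IsChernConnection.cov_bar_cov_bar (hC : IsChernConnection C) {u v w : Π x : X, T10 E x}
    (hU : IsOpen U) (hu : SmoothOn (toCT u) U) (hv : SmoothOn (toCT v) U)
    (hw : SmoothOn (toCT w) U) (hx : x ∈ U) :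
    cov C (bar u) (cov C (bar v) w) x =
      proj10 x (bracket (bar u) (bracket (bar v) (toCT w)) x) := by
  have : CompleteSpace E := FiniteDimensional.complete ℂ E
  have hF := hC.isConnection.smooth hU hv.bar hw
  have hH := hC.isConnection.smooth hU hw.bar hv
  rw [hC.complexAnalytic _ _ x (hu.diffAt hU hx) (hF.diffAt hU hx), dbar,
    bracket_congr (Filter.Eventually.of_forall fun _ => rfl) (hC.toCT_cov_bar hU hv hw hx),
    bracket_add_right ((SmoothOn.bracket hU hv.bar hw).cdiffAt hU hx) (hH.bar.cdiffAt hU hx),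
    map_add, bracket_bar_bar (hu.diffAt hU hx) (hH.diffAt hU hx)]
  rw [bar, proj10_conj, add_zero]

/-- The `(0,2)`-part of the curvature of the Chern connection vanishes. -/
lemma IsChernConnection.curvature_bar_bar (hC : IsChernConnection C) {u v w : Π x : X, T10 E x}
    (hU : IsOpen U) (hu : SmoothOn (toCT u) U) (hv : SmoothOn (toCT v) U)
    (hw : SmoothOn (toCT w) U) (hx : x ∈ U) :
    curvature C (bar u) (bar v) w x = 0 := by
  have : CompleteSpace E := FiniteDimensional.complete ℂ E
  have hB := smoothOn_proj10_bracket hU hu hv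
  have hb : ∀ᶠ y in 𝓝 x, bracket (bar u) (bar v) y =
      bar (fun y => proj10 y (bracket (toCT u) (toCT v) y)) y := by
    filter_upwards [hU.mem_nhds hx] with y hy
    exact bracket_bar_bar (hu.diffAt hU hy) (hv.diffAt hU hy)
  have h : cov C (bracket (bar u) (bar v)) w x =
      proj10 x (bracket (bracket (bar u) (bar v)) (toCT w) x) := by
    rw [bracket_congr hb (Filter.Eventually.of_forall fun _ => rfl), cov, hb.self_of_nhds]
    exact hC.complexAnalytic _ _ x (hB.diffAt hU hx) (hw.diffAt hU hx)
  -- All three terms are now (1,0)-parts of iterated brackets, and they cancel by the Jacobi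
  -- identity.
  rw [curvature, hC.cov_bar_cov_bar hU hu hv hw hx, hC.cov_bar_cov_bar hU hv hu hw hx, h,
    bracket_bracket hU hu.bar hv.bar hw hx, map_add]
  abel

/-- The first Bianchi identity for the Chern connection. -/
lemma IsChernConnection.torsionDeriv_bar (hC : IsChernConnection C) {v a b : Π x : X, T10 E x}
    (hU : IsOpen U) (hv : SmoothOn (toCT v) U) (ha : SmoothOn (toCT a) U)
    (hb : SmoothOn (toCT b) U) (hx : x ∈ U) :
    torsionDeriv C (bar v) a b x =
      curvature C (toCT b) (bar v) a x - curvature C (toCT a) (bar v) b x := by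
  have : CompleteSpace E := FiniteDimensional.complete ℂ E
  have hFa := hC.isConnection.smooth hU hv.bar ha
  have hFb := hC.isConnection.smooth hU hv.bar hb
  have hHa := hC.isConnection.smooth hU ha.bar hv
  have hHb := hC.isConnection.smooth hU hb.bar hv
  have hab := hC.isConnection.smooth hU ha hb
  have hba := hC.isConnection.smooth hU hb ha
  have hB := smoothOn_proj10_bracket hU ha hb
  have dab := hab.diffAt hU hx
  have dba := hba.diffAt hU hx
  have h1 : cov C (bar v) (torsion C a b) x = cov C (bar v) (cov C (toCT a) b) x -
      cov C (bar v) (cov C (toCT b) a) x -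
      proj10 x (bracket (bar v) (bracket (toCT a) (toCT b)) x) := by
    have e1 := hC.isConnection.sub (by simpa using dab.sub_smul 1 dba) (hB.diffAt hU hx) (bar v x)
    rw [hC.isConnection.sub dab dba] at e1
    have e2 := hC.complexAnalytic v _ x (hv.diffAt hU hx) (hB.diffAt hU hx)
    have e3 : ∀ᶠ y in 𝓝 x, toCT (fun y => proj10 y (bracket (toCT a) (toCT b) y)) y =
        bracket (toCT a) (toCT b) y := by
      filter_upwards [hU.mem_nhds hx] with y hy
      exact coe_proj10_bracket (ha.diffAt hU hy) (hb.diffAt hU hy)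
    rw [dbar, bracket_congr (Filter.Eventually.of_forall fun _ => rfl) e3] at e2
    rw [← e2]
    exact e1
  -- The bracket [p,v̄] is split by type; along its (0,1)-part the connection is ∂̄, again a
  -- bracket.
  have h2 {p q : Π x : X, T10 E x} (hp : SmoothOn (toCT p) U) (hq : SmoothOn (toCT q) U) :
      cov C (bracket (toCT p) (bar v)) q x = -cov C (toCT (cov C (bar v) p)) q x +
        proj10 x (bracket (bar (cov C (bar p) v)) (toCT q) x) := by
    have hH := hC.isConnection.smooth hU hp.bar hv
    have e := hC.complexAnalytic _ _ x (hH.diffAt hU hx) (hq.diffAt hU hx)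
    rw [dbar] at e
    rw [← e, cov, bracket_swap, hC.bracket_bar_toCT (hv.diffAt hU hx) (hp.diffAt hU hx), cov, cov,
      map_neg, map_sub]
    abel
  have h3 := bracket_congr (W := toCT b) (hC.toCT_cov_bar hU hv ha hx)
    (Filter.Eventually.of_forall fun _ => rfl)
  rw [bracket_add_left ((SmoothOn.bracket hU hv.bar ha).cdiffAt hU hx)
    (hHa.bar.cdiffAt hU hx)] at h3
  have h4 := bracket_congr (Z := toCT a) (Filter.Eventually.of_forall fun _ => rfl)
    (hC.toCT_cov_bar hU hv hb hx)
  rw [bracket_add_right ((SmoothOn.bracket hU hv.bar hb).cdiffAt hU hx)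
    (hHb.bar.cdiffAt hU hx), bracket_swap (toCT a) (bar _)] at h4
  -- The Jacobi identity for v̄, a, b removes the iterated brackets; the brackets with the (0,1)
  -- corrections in `h3` and `h4` match those from `h2`.
  rw [torsionDeriv, h1, torsion, torsion, curvature, curvature, h2 ha hb, h2 hb ha, h3, h4,
    bracket_bracket hU hv.bar ha hb hx]
  simp only [map_add, map_neg]
  abel

end Chern

end Connections

lemma dC_neg {E : Type*} [NormedAddCommGroup E] [NormedSpace ℂ E]
    {X : Type*} [TopologicalSpace X] [ChartedSpace E X] {x : X} (f : X → ℂ) (Z : CT E x) :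
    dC (-f) x Z = -dC f x Z := by
  rw [dC_apply, dC_apply, mvfderiv_neg]
  simp only [neg_apply]
  ring

lemma curvature_swap {E : Type*} [NormedAddCommGroup E] [NormedSpace ℂ E]
    {X : Type*} [TopologicalSpace X] [ChartedSpace E X] (D : T10Operator E X)
    (Z W : Π x : X, CT E x) (V : Π x : X, T10 E x) (x : X) :
    curvature D Z W V x = -curvature D W Z V x := by
  simp only [curvature, cov]
  rw [bracket_swap, map_neg]
  abel

/-! ### Unitary frames and Hermitian symmetry of curvature -/

section UnitaryFrame

variable {E : Type*} [NormedAddCommGroup E] [NormedSpace ℂ E]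
  {X : Type*} [TopologicalSpace X] [ChartedSpace E X] {x : X}
  [Bundle.RiemannianBundle (fun x : X => TangentSpace 𝓘(ℝ, E) x)]

/-- The linear form `V ↦ g(V, W̄)` on `T^{1,0}_x X`. -/
def hermForm (x : X) (W : T10 E x) : T10 E x →ₗ[ℂ] ℂ :=
  (gC x).flip (conj x (W : CT E x)) ∘ₗ (T10 E x).subtype

lemma herm_eq_hermForm (V W : Π x : X, T10 E x) (x : X) : herm V W x = hermForm x (W x) (V x) := rfl

lemma hermForm_apply (V W : T10 E x) :
    hermForm x W V = gC x (V : CT E x) (conj x (W : CT E x)) := rfl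

lemma hermForm_sub_left (V W Z : T10 E x) :
    hermForm x (V - W) Z = hermForm x V Z - hermForm x W Z := by
  simp [hermForm_apply]

lemma hermForm_swap (V W : T10 E x) : hermForm x V W = starRingEnd ℂ (hermForm x W V) := by
  rw [hermForm_apply, hermForm_apply, ← gC_conj_conj, conj_conj, gC_comm]

variable [IsManifold 𝓘(ℂ, E) ω X] {U : Set X} {n : ℕ} {e : Fin n → Π x : X, T10 E x}

lemma IsUnitaryFrameOn.sum_hermForm_smul (he : IsUnitaryFrameOn e U) (hx : x ∈ U) (Z : T10 E x) :
    ∑ r, hermForm x (e r x) Z • e r x = Z := by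
  have hZ : Z ∈ Submodule.span ℂ (Set.range fun i => e i x) := by rw [he.span hx]; trivial
  obtain ⟨c, rfl⟩ := (Submodule.mem_span_range_iff_exists_fun ℂ).1 hZ
  refine Finset.sum_congr rfl fun r _ => ?_
  have h (s : Fin n) : hermForm x (e r x) (e s x) = if s = r then 1 else 0 := he.unitary hx s r
  simp [h]

lemma IsUnitaryFrameOn.hermForm_eq_sum (he : IsUnitaryFrameOn e U) (hx : x ∈ U) (V W : T10 E x) :
    hermForm x V W =
      ∑ r, hermForm x (e r x) W * starRingEnd ℂ (hermForm x (e r x) V) := by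
  conv_lhs => rw [← he.sum_hermForm_smul hx W]
  rw [map_sum]
  refine Finset.sum_congr rfl fun r _ => ?_
  rw [map_smul, smul_eq_mul, hermForm_swap V]

lemma IsUnitaryFrameOn.ext (he : IsUnitaryFrameOn e U) (hx : x ∈ U) {Z W : T10 E x}
    (h : ∀ r, hermForm x (e r x) Z = hermForm x (e r x) W) : Z = W := by
  rw [← he.sum_hermForm_smul hx Z, ← he.sum_hermForm_smul hx W]
  simp only [h]

lemma IsUnitaryFrameOn.diffAt (he : IsUnitaryFrameOn e U) (hU : IsOpen U) (hx : x ∈ U)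
    (i : Fin n) : DiffAt (e i) x :=
  (he.smooth i).diffAt hU hx

lemma PreservesMetric.dC_herm_eq {D : T10Operator E X} (hD : PreservesMetric D)
    {v w : Π x : X, T10 E x} (hv : DiffAt v x) (hw : DiffAt w x) (Z : CT E x) :
    dC (herm v w) x Z = hermForm x (w x) (D v x Z) + hermForm x (D w x (conj x Z)) (v x) := by
  rw [hermForm_apply, hermForm_apply]
  exact hD v w x hv hw Z

/-- The curvature of a metric connection is skew-Hermitian. -/
lemma PreservesMetric.hermForm_curvature [FiniteDimensional ℂ E] {C : T10Operator E X}
    (hC : IsConnection C) (hC' : PreservesMetric C) (hU : IsOpen U) (he : IsUnitaryFrameOn e U)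
    (hx : x ∈ U) {Z W : Π x : X, CT E x} (hZ : SmoothOn Z U) (hW : SmoothOn W U) (k l : Fin n) :
    hermForm x (e l x) (curvature C Z W (e k) x) =
      -starRingEnd ℂ (hermForm x (e k x)
        (curvature C (fun y => conj y (Z y)) (fun y => conj y (W y)) (e l) x)) := by
  have : CompleteSpace E := FiniteDimensional.complete ℂ E
  have dk := he.diffAt hU hx k
  have dl := he.diffAt hU hx l
  -- Differentiating the constant h(e_k,e_l): the connection form is skew-Hermitian in a unitary
  -- frame.
  have const (y : X) (hy : y ∈ U) (V : CT E y) :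
      hermForm y (e l y) (C (e k) y V) =
        -starRingEnd ℂ (hermForm y (e k y) (C (e l) y (conj y V))) := by
    have h := hC' (e k) (e l) y (he.diffAt hU hy k) (he.diffAt hU hy l) V
    have h' : herm (e k) (e l) =ᶠ[𝓝 y] fun _ => if k = l then 1 else 0 := by
      filter_upwards [hU.mem_nhds hy] with z hz using he.unitary hz k l
    rw [dC_congr h', dC_const] at h
    rw [← hermForm_swap]
    exact eq_neg_of_add_eq_zero_left h.symm
  -- The identity `const`, read as one between functions near x, is differentiated along W.
  -- Antisymmetrizing in Z, W cancels the products of first derivatives.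
  have key {Z W : Π x : X, CT E x} (hZ : SmoothOn Z U) :
      hermForm x (e l x) (C (cov C Z (e k)) x (W x)) +
        starRingEnd ℂ (hermForm x (C (e k) x (Z x)) (C (e l) x (conj x (W x)))) =
      -(starRingEnd ℂ (hermForm x (C (e k) x (W x)) (C (e l) x (conj x (Z x))))) -
        starRingEnd ℂ (hermForm x (e k x)
          (C (cov C (fun y => conj y (Z y)) (e l)) x (conj x (W x)))) := by
    have d1 := (hC.smooth hU hZ (he.smooth k)).diffAt hU hx
    have d2 := (hC.smooth hU hZ.conj (he.smooth l)).diffAt hU hx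
    have h1 := hC' _ _ x d1 dl (W x)
    have h2 := hC' _ _ x dk d2 (W x)
    have h3 : herm (cov C Z (e k)) (e l) =ᶠ[𝓝 x]
        -herm (e k) (cov C (fun y => conj y (Z y)) (e l)) := by
      filter_upwards [hU.mem_nhds hx] with y hy
      have h := const y hy (Z y)
      rw [← hermForm_swap] at h
      exact h
    have h4 : dC (-herm (e k) (cov C (fun y => conj y (Z y)) (e l))) x (W x) =
        -dC (herm (e k) (cov C (fun y => conj y (Z y)) (e l))) x (W x) := dC_neg _ _
    rw [dC_congr h3, h4, h2] at h1
    rw [← hermForm_swap, ← hermForm_swap, ← hermForm_swap]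
    refine h1.symm.trans ?_
    rw [neg_add, ← sub_eq_add_neg]
    rfl
  have hb : conj x (bracket Z W x) = _ := conj_bracket (hZ.cdiffAt hU hx) (hW.cdiffAt hU hx)
  have e1 := key (W := W) hZ
  have e2 := key (W := Z) hW
  have e3 := const x hx (bracket Z W x)
  rw [hb] at e3
  simp only [curvature, map_sub]
  simp only [cov] at *
  linear_combination e2 - e1 - e3

/-- Conjugation sends the pair (e_a, ē_b) to (ē_a, e_b); exchanging the arguments absorbs the sign
of skew-Hermitian symmetry. This removes the conjugates from Bianchi terms. -/
lemma IsChernConnection.hermForm_curvature_toCT_bar [FiniteDimensional ℂ E] {C : T10Operator E X}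
    (hC : IsChernConnection C) (hU : IsOpen U) (he : IsUnitaryFrameOn e U) (hx : x ∈ U)
    (a b c d : Fin n) :
    hermForm x (curvature C (toCT (e a)) (bar (e b)) (e c) x) (e d x) =
      hermForm x (e c x) (curvature C (toCT (e b)) (bar (e a)) (e d) x) := by
  have hb : (fun y => conj y (bar (e b) y)) = toCT (e b) := funext fun y => conj_conj _
  have ha : (fun y => conj y (toCT (e a) y)) = bar (e a) := rfl
  rw [hermForm_swap, PreservesMetric.hermForm_curvature hC.isConnection hC.hermitian hU he hx
    (he.smooth a) (he.smooth b).bar, ha, hb, curvature_swap, map_neg, map_neg,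
    Complex.conj_conj, neg_neg]

/-- The `(2,0)`-part of the curvature of the Chern connection vanishes. -/
lemma IsChernConnection.hermForm_curvature_toCT_toCT [FiniteDimensional ℂ E]
    {C : T10Operator E X} (hC : IsChernConnection C) (hU : IsOpen U) (he : IsUnitaryFrameOn e U)
    (hx : x ∈ U) (a b c d : Fin n) :
    hermForm x (e d x) (curvature C (toCT (e a)) (toCT (e b)) (e c) x) = 0 := by
  have h (i : Fin n) : (fun y => conj y (toCT (e i) y)) = bar (e i) := rfl
  rw [PreservesMetric.hermForm_curvature hC.isConnection hC.hermitian hU he hx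
    (he.smooth a) (he.smooth b), h, h,
    hC.curvature_bar_bar hU (he.smooth a) (he.smooth b) (he.smooth d) hx]
  simp

end UnitaryFrame

/-! ### Pointwise form of the defect and tensoriality of the torsion -/

section Gauduchon

variable {E : Type*} [NormedAddCommGroup E] [NormedSpace ℂ E] [FiniteDimensional ℂ E]
  {X : Type*} [TopologicalSpace X] [ChartedSpace E X] {x : X} [IsManifold 𝓘(ℂ, E) ω X]
  [Bundle.RiemannianBundle (fun x : X => TangentSpace 𝓘(ℝ, E) x)]
  [IsContMDiffRiemannianBundle 𝓘(ℝ, E) ∞ E (fun x : X => TangentSpace 𝓘(ℝ, E) x)]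
  {C : T10Operator E X} {L : CovariantDerivative 𝓘(ℝ, E) E (fun x : X => TangentSpace 𝓘(ℝ, E) x)}
  {U : Set X} {n : ℕ} {e : Fin n → Π x : X, T10 E x}

lemma chernDefect_toCT (hg : IsHermitianMetric E X) (hC : IsChernConnection C)
    (hL : IsLeviCivita L) (hU : IsOpen U) (he : IsUnitaryFrameOn e U) (hx : x ∈ U)
    {u v : Π x : X, T10 E x} (hu : DiffAt u x) (hv : DiffAt v x) :
    chernDefect C L v x (toCT u x) = torsion C u v x := by
  refine he.ext hx fun r => ?_
  have h := gC_chernDefect_toCT hg hC hL hu hv (he.diffAt hU hx r)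
  rw [bar] at h
  rw [hermForm_apply, hermForm_apply, h]

lemma torsion_eq_neg_chernDefect (hg : IsHermitianMetric E X) (hC : IsChernConnection C)
    (hL : IsLeviCivita L) (hU : IsOpen U) (he : IsUnitaryFrameOn e U) (hx : x ∈ U)
    {u v : Π x : X, T10 E x} (hu : DiffAt u x) (hv : DiffAt v x) :
    torsion C u v x = -chernDefect C L u x (toCT v x) := by
  rw [torsion_swap, chernDefect_toCT hg hC hL hU he hx hv hu]

lemma hermForm_chernDefect_bar (hg : IsHermitianMetric E X) (hC : IsChernConnection C)
    (hL : IsLeviCivita L) {u v w : Π x : X, T10 E x} (hu : DiffAt u x) (hv : DiffAt v x)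
    (hw : DiffAt w x) :
    hermForm x (w x) (chernDefect C L v x (bar u x)) = -hermForm x (torsion C u w x) (v x) := by
  have h := gC_chernDefect_bar hg hC hL hu hv hw
  rw [show bar w x = conj x (w x : CT E x) from rfl, show toCT v x = (v x : CT E x) from rfl,
    show bar (torsion C u w) x = conj x (torsion C u w x : CT E x) from rfl] at h
  rw [hermForm_apply, hermForm_apply, h]

/-- Tensoriality comes from `chernDefect_toCT`: the defect is by construction a linear map of the
direction at x, so no Leibniz computation with brackets is needed. Antisymmetry transfers this to
the other argument. -/
lemma hermForm_torsion_left (hg : IsHermitianMetric E X) (hC : IsChernConnection C)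
    (hL : IsLeviCivita L) (hU : IsOpen U) (he : IsUnitaryFrameOn e U) (hx : x ∈ U)
    {u v : Π x : X, T10 E x} (hu : DiffAt u x) (hv : DiffAt v x) (w : T10 E x) :
    hermForm x w (torsion C u v x) =
      ∑ r, hermForm x (e r x) (u x) * hermForm x w (torsion C (e r) v x) := by
  have h (r : Fin n) := chernDefect_toCT hg hC hL hU he hx (he.diffAt hU hx r) hv
  have hs : toCT u x = ∑ r, hermForm x (e r x) (u x) • toCT (e r) x := by
    have := congrArg (fun z : T10 E x => (z : CT E x)) (he.sum_hermForm_smul hx (u x))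
    simpa [toCT] using this.symm
  rw [← chernDefect_toCT hg hC hL hU he hx hu hv, hs]
  simp [h]

lemma hermForm_torsion_right (hg : IsHermitianMetric E X) (hC : IsChernConnection C)
    (hL : IsLeviCivita L) (hU : IsOpen U) (he : IsUnitaryFrameOn e U) (hx : x ∈ U)
    {u v : Π x : X, T10 E x} (hu : DiffAt u x) (hv : DiffAt v x) (w : T10 E x) :
    hermForm x w (torsion C u v x) =
      ∑ r, hermForm x (e r x) (v x) * hermForm x w (torsion C u (e r) x) := by
  rw [torsion_swap, map_neg, hermForm_torsion_left hg hC hL hU he hx hv hu,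
    ← Finset.sum_neg_distrib]
  refine Finset.sum_congr rfl fun r _ => ?_
  rw [torsion_swap C u, map_neg, mul_neg]

lemma torsion_sub_smul_right (hg : IsHermitianMetric E X) (hC : IsChernConnection C)
    (hL : IsLeviCivita L) (hU : IsOpen U) (he : IsUnitaryFrameOn e U) (hx : x ∈ U)
    {u v w F : Π x : X, T10 E x} {s : ℂ} (hu : DiffAt u x) (hv : DiffAt v x) (hw : DiffAt w x)
    (hF : DiffAt F x) (h : F x = v x - s • w x) :
    torsion C u F x = torsion C u v x - s • torsion C u w x := by
  have h' : toCT F x = toCT v x - s • toCT w x := congrArg (fun z : T10 E x => (z : CT E x)) h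
  rw [torsion_eq_neg_chernDefect hg hC hL hU he hx hu hF,
    torsion_eq_neg_chernDefect hg hC hL hU he hx hu hv,
    torsion_eq_neg_chernDefect hg hC hL hU he hx hu hw, h', map_sub, map_smul]
  module

end Gauduchon

/-! ### Curvature of the Gauduchon connections -/

section GauduchonCurvature

variable {E : Type*} [NormedAddCommGroup E] [NormedSpace ℂ E]
  {X : Type*} [TopologicalSpace X] [ChartedSpace E X] {x : X} [IsManifold 𝓘(ℂ, E) ω X]
  {C : T10Operator E X}
  {L : CovariantDerivative 𝓘(ℝ, E) E (fun x : X => TangentSpace 𝓘(ℝ, E) x)}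

/-- The derivative of a Gauduchon covariant derivative of a section. -/
lemma gauduchon_cov (hC : IsConnection C) {s : ℂ} {t : ℝ} (hs : (1 - (t : ℂ)) / 2 = s)
    {V A B : Π x : X, T10 E x} {Z : Π x : X, CT E x}
    (hA : DiffAt A x) (hB : DiffAt B x)
    (h : ∀ᶠ y in 𝓝 x, cov (gauduchon C L t) Z V y = A y - s • B y) (W : CT E x) :
    gauduchon C L t (cov (gauduchon C L t) Z V) x W = C A x W - s • C B x W -
      s • chernDefect C L (cov (gauduchon C L t) Z V) x W := by
  have hAB := hA.sub_smul s hB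
  rw [gauduchon_eq, hs, ← hC.congr hAB (h.mono fun y hy => hy.symm), hC.sub_smul hA s hB]

variable [FiniteDimensional ℂ E] [Bundle.RiemannianBundle (fun x : X => TangentSpace 𝓘(ℝ, E) x)]
  [IsContMDiffRiemannianBundle 𝓘(ℝ, E) ∞ E (fun x : X => TangentSpace 𝓘(ℝ, E) x)]
  {U : Set X} {n : ℕ} {e : Fin n → Π x : X, T10 E x}

/-- Here A_u = T(u,·). Writing [u,v] as ∇_u v - ∇_v u - T(u,v) completes the derivatives of T to
covariant derivatives and leaves the term in T(T(u,v),k). -/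
lemma curvature_gauduchon_toCT_toCT (hg : IsHermitianMetric E X) (hC : IsChernConnection C)
    (hL : IsLeviCivita L) (hU : IsOpen U) (he : IsUnitaryFrameOn e U) (hx : x ∈ U)
    {s : ℂ} {t : ℝ} (hs : (1 - (t : ℂ)) / 2 = s)
    {u v k : Π x : X, T10 E x} (hu : SmoothOn (toCT u) U) (hv : SmoothOn (toCT v) U)
    (hk : SmoothOn (toCT k) U) :
    curvature (gauduchon C L t) (toCT u) (toCT v) k x =
      curvature C (toCT u) (toCT v) k x +
        s • (torsionDeriv C (toCT v) u k x - torsionDeriv C (toCT u) v k x) +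
        s ^ 2 • (torsion C u (torsion C v k) x - torsion C v (torsion C u k) x) -
        s • torsion C (torsion C u v) k x := by
  have : CompleteSpace E := FiniteDimensional.complete ℂ E
  have key {u v : Π x : X, T10 E x} (hu : SmoothOn (toCT u) U) (hv : SmoothOn (toCT v) U) :
      gauduchon C L t (cov (gauduchon C L t) (toCT v) k) x (toCT u x) =
        C (cov C (toCT v) k) x (toCT u x) - s • C (torsion C v k) x (toCT u x) -
          s • (torsion C u (cov C (toCT v) k) x - s • torsion C u (torsion C v k) x) := by
    have hA := (hC.isConnection.smooth hU hv hk).diffAt hU hx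
    have hB := (hC.isConnection.smoothOn_torsion hU hv hk).diffAt hU hx
    have h (y : X) (hy : y ∈ U) : cov (gauduchon C L t) (toCT v) k y =
        cov C (toCT v) k y - s • torsion C v k y := by
      rw [cov, gauduchon_eq, hs,
        chernDefect_toCT hg hC hL hU he hy (hv.diffAt hU hy) (hk.diffAt hU hy)]
      rfl
    have hF := (hA.sub_smul s hB).congr
      (W := cov (gauduchon C L t) (toCT v) k) (by
        filter_upwards [hU.mem_nhds hx] with y hy using (h y hy).symm)
    rw [gauduchon_cov hC.isConnection hs hA hB
        (by filter_upwards [hU.mem_nhds hx] with y hy using h y hy),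
      chernDefect_toCT hg hC hL hU he hx (hu.diffAt hU hx) hF,
      torsion_sub_smul_right hg hC hL hU he hx (hu.diffAt hU hx) hA hB hF (h x hx)]
  have du := hu.diffAt hU hx
  have dv := hv.diffAt hU hx
  have dk := hk.diffAt hU hx
  have hb : bracket (toCT u) (toCT v) x = toCT (cov C (toCT u) v) x - toCT (cov C (toCT v) u) x -
      toCT (torsion C u v) x := by
    rw [toCT, toCT, toCT, torsion]
    simp only [Submodule.coe_sub]
    rw [coe_proj10_bracket du dv]
    abel
  have q {w : Π x : X, T10 E x} (hw : SmoothOn (toCT w) U) :=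
    chernDefect_toCT hg hC hL hU he hx (hw.diffAt hU hx) dk
  have hbr : chernDefect C L k x (bracket (toCT u) (toCT v) x) =
      torsion C (cov C (toCT u) v) k x - torsion C (cov C (toCT v) u) k x -
        torsion C (torsion C u v) k x := by
    rw [hb, map_sub, map_sub, q (hC.isConnection.smooth hU hu hv),
      q (hC.isConnection.smooth hU hv hu), q (hC.isConnection.smoothOn_torsion hU hu hv)]
  have h3 : cov (gauduchon C L t) (bracket (toCT u) (toCT v)) k x =
      C k x (bracket (toCT u) (toCT v) x) - s • (torsion C (cov C (toCT u) v) k x -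
        torsion C (cov C (toCT v) u) k x - torsion C (torsion C u v) k x) := by
    rw [cov, gauduchon_eq, hs, hbr]
  have h1 := key hu hv
  have h2 := key hv hu
  rw [curvature, h3]
  change gauduchon C L t (cov (gauduchon C L t) (toCT v) k) x (toCT u x) -
    gauduchon C L t (cov (gauduchon C L t) (toCT u) k) x (toCT v x) - _ = _
  rw [h1, h2]
  simp only [curvature, torsionDeriv]
  simp only [cov]
  module

/-- The defect `P = ⟨k, T(v, ·)⟩` of the `(0,1)`-derivative along `v̄` of `k` is differentiable. -/
lemma diffAt_chernDefect_bar (hg : IsHermitianMetric E X) (hC : IsChernConnection C)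
    (hL : IsLeviCivita L) (hU : IsOpen U) (he : IsUnitaryFrameOn e U) (hx : x ∈ U)
    {v k : Π x : X, T10 E x} (hv : SmoothOn (toCT v) U) (hk : SmoothOn (toCT k) U) (i : Fin n) :
    DiffAt (cov (chernDefect C L) (bar v) k) x := by
  have hT (r : Fin n) := (hC.isConnection.smoothOn_torsion hU hv (he.smooth r)).diffAt hU hx
  have hf (r : Fin n) : MDifferentiableAt 𝓘(ℝ, E) 𝓘(ℝ, ℂ)
      (fun y => hermForm y (torsion C v (e r) y) (k y)) x :=
    (hk.diffAt hU hx).toCT.gC (hT r).bar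
  -- In the frame the coefficients of the defect are -h(k, T(v,e_r)). The index `i` witnesses that
  -- the sum is nonempty.
  have hs := DiffAt.sum Finset.univ ⟨i, Finset.mem_univ i⟩
    fun r => DiffAt.smul (hf r).neg (he.diffAt hU hx r)
  refine hs.congr ?_
  filter_upwards [hU.mem_nhds hx] with y hy
  rw [← he.sum_hermForm_smul hy (cov (chernDefect C L) (bar v) k y)]
  refine Finset.sum_congr rfl fun r _ => ?_
  rw [cov, hermForm_chernDefect_bar hg hC hL (hv.diffAt hU hy) (hk.diffAt hU hy)
    (he.diffAt hU hy r)]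
  rfl

/-- The defect along v̄ is known only through h(A_v̄ k, l) = -h(k, T(v,l)), so its Chern derivative
is found by differentiating both sides with the metric identity. -/
lemma hermForm_cov_chernDefect (hg : IsHermitianMetric E X) (hC : IsChernConnection C)
    (hL : IsLeviCivita L) (hU : IsOpen U) (he : IsUnitaryFrameOn e U) (hx : x ∈ U)
    {u v k l : Π x : X, T10 E x} (hu : SmoothOn (toCT u) U) (hv : SmoothOn (toCT v) U)
    (hk : SmoothOn (toCT k) U) (hl : SmoothOn (toCT l) U) (i : Fin n) :
    hermForm x (l x) (C (cov (chernDefect C L) (bar v) k) x (toCT u x)) =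
      hermForm x (torsion C v (cov C (bar u) l) x) (k x) -
      hermForm x (torsion C v l x) (C k x (toCT u x)) -
      hermForm x (C (torsion C v l) x (bar u x)) (k x) := by
  have dT := (hC.isConnection.smoothOn_torsion hU hv hl).diffAt hU hx
  have dP := diffAt_chernDefect_bar hg hC hL hU he hx hv hk i
  have dk := hk.diffAt hU hx
  have dl := hl.diffAt hU hx
  have h : herm (cov (chernDefect C L) (bar v) k) l =ᶠ[𝓝 x] -herm k (torsion C v l) := by
    filter_upwards [hU.mem_nhds hx] with y hy
    rw [Pi.neg_apply, herm_eq_hermForm, herm_eq_hermForm, cov,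
      hermForm_chernDefect_bar hg hC hL (hv.diffAt hU hy) (hk.diffAt hU hy) (hl.diffAt hU hy)]
  have h1 := hC.hermitian.dC_herm_eq dP dl (toCT u x)
  have h2 := hC.hermitian.dC_herm_eq dk dT (toCT u x)
  rw [show conj x (toCT u x) = bar u x from rfl] at h1 h2
  have h3 : hermForm x (C l x (bar u x)) (cov (chernDefect C L) (bar v) k x) =
      -hermForm x (torsion C v (cov C (bar u) l) x) (k x) := by
    rw [← hermForm_chernDefect_bar hg hC hL (hv.diffAt hU hx) dk
      ((hC.isConnection.smooth hU hu.bar hl).diffAt hU hx), cov, cov]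
  rw [dC_congr h, dC_neg, h2, h3] at h1
  linear_combination -h1

/-- The (0,1)- and (1,0)-parts of [u,v̄], namely conj(∇_ū v) and -∇_v̄ u, supply the terms
completing the two covariant derivatives of T. The quadratic part is A_u A_v̄ k - A_v̄ A_u k, whose
first product is expanded in the frame. -/
lemma hermForm_curvature_gauduchon_toCT_bar (hg : IsHermitianMetric E X)
    (hC : IsChernConnection C)
    (hL : IsLeviCivita L) (hU : IsOpen U) (he : IsUnitaryFrameOn e U) (hx : x ∈ U)
    {s : ℂ} {t : ℝ} (hs : (1 - (t : ℂ)) / 2 = s)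
    {u v k l : Π x : X, T10 E x} (hu : SmoothOn (toCT u) U) (hv : SmoothOn (toCT v) U)
    (hk : SmoothOn (toCT k) U) (hl : SmoothOn (toCT l) U) (i : Fin n) :
    hermForm x (l x) (curvature (gauduchon C L t) (toCT u) (bar v) k x) =
      hermForm x (l x) (curvature C (toCT u) (bar v) k x) +
        s * (hermForm x (l x) (torsionDeriv C (bar v) u k x) +
          hermForm x (torsionDeriv C (bar u) v l x) (k x)) +
        s ^ 2 * (hermForm x (torsion C v l x) (torsion C u k x) -
          ∑ r, hermForm x (torsion C v (e r) x) (k x) *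
            hermForm x (l x) (torsion C u (e r) x)) := by
  have du := hu.diffAt hU hx
  have dv := hv.diffAt hU hx
  have dk := hk.diffAt hU hx
  have dl := hl.diffAt hU hx
  have dA := (hC.isConnection.smooth hU hv.bar hk).diffAt hU hx
  have dP := diffAt_chernDefect_bar hg hC hL hU he hx hv hk i
  have dA' := (hC.isConnection.smooth hU hu hk).diffAt hU hx
  have dT := (hC.isConnection.smoothOn_torsion hU hu hk).diffAt hU hx
  have hF (y : X) : cov (gauduchon C L t) (bar v) k y =
      cov C (bar v) k y - s • cov (chernDefect C L) (bar v) k y := by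
    rw [cov, gauduchon_eq, hs]; rfl
  have hG (y : X) (hy : y ∈ U) : cov (gauduchon C L t) (toCT u) k y =
      cov C (toCT u) k y - s • torsion C u k y := by
    rw [cov, gauduchon_eq, hs,
      chernDefect_toCT hg hC hL hU he hy (hu.diffAt hU hy) (hk.diffAt hU hy)]
    rfl
  have dF := (dA.sub_smul s dP).congr (Filter.Eventually.of_forall fun y => (hF y).symm)
  have dG := (dA'.sub_smul s dT).congr (W := cov (gauduchon C L t) (toCT u) k) (by
    filter_upwards [hU.mem_nhds hx] with y hy using (hG y hy).symm)
  have h1 : hermForm x (l x) (cov (gauduchon C L t) (toCT u)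
      (cov (gauduchon C L t) (bar v) k) x) = _ := congrArg (hermForm x (l x))
    (gauduchon_cov (L := L) hC.isConnection hs dA dP (Filter.Eventually.of_forall hF) (toCT u x))
  have h2 : hermForm x (l x) (cov (gauduchon C L t) (bar v)
      (cov (gauduchon C L t) (toCT u) k) x) = _ := congrArg (hermForm x (l x))
    (gauduchon_cov (L := L) hC.isConnection hs dA' dT
      (by filter_upwards [hU.mem_nhds hx] with y hy using hG y hy) (bar v x))
  have hb : bracket (toCT u) (bar v) x =
      bar (cov C (bar u) v) x - toCT (cov C (bar v) u) x := by
    rw [bracket_swap, hC.bracket_bar_toCT dv du, neg_sub]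
  have h3 : hermForm x (l x) (cov (gauduchon C L t) (bracket (toCT u) (bar v)) k x) =
      hermForm x (l x) (cov C (bracket (toCT u) (bar v)) k x) +
        s * (hermForm x (torsion C (cov C (bar u) v) l x) (k x) +
          hermForm x (l x) (torsion C (cov C (bar v) u) k x)) := by
    have e1 := hermForm_chernDefect_bar hg hC hL
      ((hC.isConnection.smooth hU hu.bar hv).diffAt hU hx) dk dl
    have e2 := chernDefect_toCT hg hC hL hU he hx
      ((hC.isConnection.smooth hU hv.bar hu).diffAt hU hx) dk
    rw [cov, gauduchon_eq, hs, hb, map_sub (chernDefect C L k x), e2, ← hb, map_sub, map_smul,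
      map_sub, e1, cov, smul_eq_mul]
    ring
  have h4 : hermForm x (l x) (torsion C u (cov (chernDefect C L) (bar v) k) x) =
      -∑ r, hermForm x (torsion C v (e r) x) (k x) * hermForm x (l x) (torsion C u (e r) x) := by
    rw [hermForm_torsion_right hg hC hL hU he hx du dP, ← Finset.sum_neg_distrib]
    refine Finset.sum_congr rfl fun r _ => ?_
    rw [cov, hermForm_chernDefect_bar hg hC hL dv dk (he.diffAt hU hx r), neg_mul]
  rw [chernDefect_toCT hg hC hL hU he hx du dF,
    torsion_sub_smul_right hg hC hL hU he hx du dA dP dF (hF x)] at h1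
  simp only [map_sub, map_smul, smul_eq_mul] at h1 h2
  rw [hermForm_cov_chernDefect hg hC hL hU he hx hu hv hk hl i, h4] at h1
  rw [hermForm_chernDefect_bar hg hC hL dv dG dl, hG x hx] at h2
  simp only [map_sub, map_smul, smul_eq_mul] at h2
  simp only [curvature, torsionDeriv, map_sub, hermForm_sub_left, h1, h2, h3]
  simp only [cov]
  ring

end GauduchonCurvature

end HermitianGeometry

end

/-! ### Assembly in the unitary frame -/

theorem mainTheorem7
    {E : Type*} [NormedAddCommGroup E] [NormedSpace ℂ E] [FiniteDimensional ℂ E]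
    {X : Type*} [TopologicalSpace X] [ChartedSpace E X] [IsManifold 𝓘(ℂ, E) ω X]
    [Bundle.RiemannianBundle (fun x : X => TangentSpace 𝓘(ℝ, E) x)]
    [IsContMDiffRiemannianBundle 𝓘(ℝ, E) ∞ E (fun x : X => TangentSpace 𝓘(ℝ, E) x)]
    (hg : IsHermitianMetric E X)
    (C : T10Operator E X) (hC : IsChernConnection C)
    (L : CovariantDerivative 𝓘(ℝ, E) E (fun x : X => TangentSpace 𝓘(ℝ, E) x))
    (hL : IsLeviCivita L)
    (t : ℝ) {n : ℕ} (U : Set X) (hU : IsOpen U)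
    (e : Fin n → Π x : X, T10 E x) (he : IsUnitaryFrameOn e U)
    (x : X) (hx : x ∈ U) (i j k l : Fin n) :
    R11 (gauduchon C L t) e x i j k l =
        t * R11 C e x i j k l +
          (1 - t) / 2 * (R11 C e x k j i l + R11 C e x i l k j) +
          ((1 - t) / 2) ^ 2 *
            (∑ r, tors C e x i k r * star (tors C e x j l r) -
              ∑ r, tors C e x i r l * star (tors C e x j r k)) ∧
      R20 (gauduchon C L t) e x i j k l =
        (1 - t) / 2 * (torsDeriv C e x i k l j - torsDeriv C e x j k l i) +
          ((1 - t) / 2) ^ 2 *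
            (∑ r, tors C e x j k r * tors C e x i r l -
              ∑ r, tors C e x i k r * tors C e x j r l) -
          (1 - t) / 2 * ∑ r, tors C e x i j r * tors C e x r k l := by
  have hs : (1 - (t : ℂ)) / 2 = (1 - t) / 2 := rfl
  have sm := he.smooth
  have df (i : Fin n) := he.diffAt hU hx i
  have dT (i j : Fin n) := (hC.isConnection.smoothOn_torsion hU (sm i) (sm j)).diffAt hU hx
  simp only [R11, R20, tors, torsDeriv, herm_eq_hermForm]
  constructor
  · have b1 := hC.torsionDeriv_bar hU (sm j) (sm i) (sm k) hx
    have b2 := hC.torsionDeriv_bar hU (sm i) (sm j) (sm l) hx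
    have c1 := hC.hermForm_curvature_toCT_bar hU he hx l i j k
    have c2 := hC.hermForm_curvature_toCT_bar hU he hx j i l k
    have h4 : ∑ r, hermForm x (torsion C (e j) (e r) x) (e k x) *
        hermForm x (e l x) (torsion C (e i) (e r) x) =
        ∑ r, hermForm x (e l x) (torsion C (e i) (e r) x) *
          star (hermForm x (e k x) (torsion C (e j) (e r) x)) :=
      Finset.sum_congr rfl fun r _ => by
        rw [hermForm_swap (torsion C (e j) (e r) x), mul_comm]; rfl
    -- Each of the Bianchi identities `b1` and `b2` contributes -R_{i j̄ k l̄} with weight (1-t)/2,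
    -- so the total coefficient of that component is 1 - (1-t) = t.
    rw [hermForm_curvature_gauduchon_toCT_bar hg hC hL hU he hx hs (sm i) (sm j) (sm k) (sm l) i,
      b1, b2, hermForm_sub_left, map_sub, c1, c2, h4,
      he.hermForm_eq_sum hx (torsion C (e j) (e l) x)]
    simp only [starRingEnd_apply]
    ring
  · rw [curvature_gauduchon_toCT_toCT hg hC hL hU he hx hs (sm i) (sm j) (sm k)]
    have h0 := hC.hermForm_curvature_toCT_toCT hU he hx i j k l
    simp only [map_add, map_sub, map_smul, smul_eq_mul, h0]
    rw [hermForm_torsion_right hg hC hL hU he hx (df i) (dT j k),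
      hermForm_torsion_right hg hC hL hU he hx (df j) (dT i k),
      hermForm_torsion_left hg hC hL hU he hx (dT i j) (df k)]
    ring
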